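/- Let $k$ be a field, let $n\ge 3$ be odd, and let $\delta,\delta_L,\delta_R,\kappa_L,\kappa_R,\kappa_{LR}\in k$ satisfy $\delta=\kappa_L=\kappa_R$ and $\delta_L=\delta_R=\kappa_{LR}=1$. A left-right blob pseudo-diagram is a planar diagram in a rectangle with $n$ endpoints on the top edge and $n$ on the bottom edge, joined in pairs by non-crossing strands, possibly with closed loops, whose lines carry finitely many left blobs $L$ and right blobs $R$, such that all the left blobs can be taken to the left edge and all the right blobs to the right edge simultaneously, without crossing lines. For $n$ odd, the symplectic blob algebra $b_n^x=b_n^x(\delta,\delta_L,\delta_R,\kappa_L,\kappa_R,\kappa_{LR})$ is the $k$-algebra of $k$-linear combinations of such pseudo-diagrams, with multiplication by concatenation, modulo the straightening relations: a closed loop without blobs is replaced by $\delta$, a loop with exactly one blob $L$ (respectively $R$) by $\kappa_L$ (respectively $\kappa_R$), a loop with one $L$ and one $R$ by $\kappa_{LR}$; and on any line two consecutive blobs $LL$ are replaced by $\delta_L L$, $RR$ by $\delta_R R$, three consecutive blobs $LRL$ by $\kappa_{LR}L$, and $RLR$ by $\kappa_{LR}R$. (The additional topological relation in the definition of $b_n^x$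 only concerns diagrams without a strand from top to bottom, so it is void for $n$ odd.) Let $e$ (respectively $f$) be the identity diagram with one $L$ on its first strand (respectively one $R$ on its last strand), and let $I$ be the two-sided ideal of $b_n^x$ generated by $e-1$ and $f-1$. Let $TL_n$ be the Temperley--Lieb algebra with loop parameter $\delta$: its $k$-basis consists of the non-crossing diagrams without blobs and without closed loops, and the product is concatenation with each closed loop replaced by $\delta$. Then there is an isomorphism of $k$-algebras $b_n^x/I\cong TL_n$ that sends the class of each left-right blob diagram (without closed loops) to the Temperley--Lieb diagram obtained from it by removing all the blobs. -/

import Mathlib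

/-! ## Decorated diagrams

An `(n,n)`-diagram has `n` endpoints on the top edge of a rectangle and `n` on the bottom edge; its
strands join the endpoints in pairs and carry words in two kinds of blobs; in addition it may have
closed loops. Concatenation glues the bottom endpoints of the first (upper) diagram to the top
endpoints of the second (lower) one. -/

namespace SympBlob

/-- Left blobs `L` (black) and right blobs `R` (white). -/
inductive Blob
  | L
  | R
  deriving DecidableEq

/-- A system of strands with endpoints in `X`: `next x` is the other end of the strand at `x`, and
`word x` is the sequence of blobs met when that strand is followed from `x` to `next x`. A point with
`next x = x` is absent (not an endpoint of any strand). `loops` records the closed loops, each by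
the pair (number of left blobs, number of right blobs) on it. -/
@[ext] structure Strands (X : Type) where
  next : X → X
  word : X → List Blob
  loops : Multiset (ℕ × ℕ)

namespace Strands

/-- The pairing is symmetric, and following a strand backwards reverses its word. -/
structure Proper {X : Type} (s : Strands X) : Prop where
  next_next : ∀ x, s.next (s.next x) = x
  word_next : ∀ x, s.word (s.next x) = (s.word x).reverse

/-- The numbers of left and of right blobs. -/
def loopType (w : List Blob) : ℕ × ℕ := (w.count Blob.L, w.count Blob.R)

/-- Glue the endpoints `p` and `q`, which then disappear: if they are the two ends of one strand,
this strand becomes a closed loop; otherwise the two strands ending in `p` and in `q` are joined,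
and their words are concatenated. -/
def glue {X : Type} [DecidableEq X] (s : Strands X) (p q : X) : Strands X where
  next x :=
    if x = p ∨ x = q then x
    else if s.next x = p then s.next q
    else if s.next x = q then s.next p
    else s.next x
  word x :=
    if x = p ∨ x = q then []
    else if s.next x = p then s.word x ++ s.word q
    else if s.next x = q then s.word x ++ s.word p
    else s.word x
  loops := if s.next p = q then loopType (s.word p) ::ₘ s.loops else s.loops

/-- Glue several pairs of endpoints, one after the other. -/
def gluePairs {X : Type} [DecidableEq X] (s : Strands X) (l : List (X × X)) : Strands X :=
  l.foldl (fun t pq => t.glue pq.1 pq.2) s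

/-- Two systems of strands side by side. -/
def juxt {X Y : Type} (s : Strands X) (t : Strands Y) : Strands (X ⊕ Y) where
  next := Sum.map s.next t.next
  word := Sum.elim s.word t.word
  loops := s.loops + t.loops

end Strands

/-- The endpoints of an `(n,n)`-diagram: `Sum.inl i` is the `i`-th one on the top edge, `Sum.inr i`
the `i`-th one on the bottom edge, both counted from the left. -/
abbrev Point (n : ℕ) : Type := Fin n ⊕ Fin n

/-- The pairs of endpoints glued in a concatenation: the `i`-th bottom endpoint of the first diagram
with the `i`-th top endpoint of the second. -/
def seam (n : ℕ) : List ((Point n ⊕ Point n) × (Point n ⊕ Point n)) :=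
  (List.finRange n).map fun i => (Sum.inl (Sum.inr i), Sum.inr (Sum.inl i))

/-- The endpoints that remain: the top ones of the first and the bottom ones of the second. -/
def outer {n : ℕ} : Point n → Point n ⊕ Point n
  | Sum.inl i => Sum.inl (Sum.inl i)
  | Sum.inr i => Sum.inr (Sum.inr i)

/-- Concatenation, `s` above `t`. (The map `Sum.elim id id` is the inverse of `outer` on the
endpoints that remain.) -/
def Strands.concat {n : ℕ} (s t : Strands (Point n)) : Strands (Point n) where
  next x := Sum.elim id id (((s.juxt t).gluePairs (seam n)).next (outer x))
  word x := ((s.juxt t).gluePairs (seam n)).word (outer x)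
  loops := ((s.juxt t).gluePairs (seam n)).loops

/-- Brauer `(n,n)`-diagrams (crossings allowed) with blobs on the strands and with closed loops. -/
@[ext] structure Diagram (n : ℕ) extends Strands (Point n) where
  next_next : ∀ x, next (next x) = x
  next_ne : ∀ x, next x ≠ x
  word_next : ∀ x, word (next x) = (word x).reverse

/-- The position of an endpoint on the boundary of the rectangle, going round from the left edge
along the top edge to the right edge, and back along the bottom edge. -/
def pos {n : ℕ} : Point n → ℕ
  | Sum.inl i => i
  | Sum.inr i => 2 * n - 1 - i

/-- No crossings: each strand has both or none of the ends of any other strand between its own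
ends (`pos` lists the endpoints in their order on the boundary). -/
def Strands.Planar {X : Type} (pos : X → ℕ) (s : Strands X) : Prop :=
  ∀ c x, x ≠ c → x ≠ s.next c →
    ((pos c < pos x ∧ pos x < pos (s.next c)) ↔
      (pos c < pos (s.next x) ∧ pos (s.next x) < pos (s.next c)))

/-- The strand at `x` can be deformed, without crossing another strand, to touch the boundary just
before position `z`: no other strand separates it from that part of the boundary, i.e. the boundary
part lies between the ends of another strand if and only if `x` does. -/
def Strands.Reaches {X : Type} (pos : X → ℕ) (s : Strands X) (z : ℕ) (x : X) : Prop :=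
  ∀ c, c ≠ x → c ≠ s.next x → pos c < pos (s.next c) →
    ((pos c < z ∧ z ≤ pos (s.next c)) ↔ (pos c < pos x ∧ pos x < pos (s.next c)))

/-- Diagrams without crossings in which only `L`-exposed strands carry left blobs and only
`R`-exposed strands carry right blobs. The left edge of the rectangle lies before position `0`, the
right edge just before position `n`. (For `n` odd there is a strand from top to bottom, so no region
touches both the left and the right edge; hence all the left blobs can be taken to the left edge
and all the right blobs to the right edge at the same time.) -/
structure Diagram.IsLeftRight {n : ℕ} (d : Diagram n) : Prop where
  planar : d.Planar pos
  left : ∀ x, Blob.L ∈ d.word x → d.Reaches pos 0 x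
  right : ∀ x, Blob.R ∈ d.word x → d.Reaches pos n x

/-! ### Gluing: order and invariance -/

namespace Strands
variable {X Y : Type}

lemma loopType_append (u v : List Blob) : loopType (u ++ v) = loopType u + loopType v := by
  simp [loopType]

lemma loopType_reverse (u : List Blob) : loopType u.reverse = loopType u := by
  simp [loopType]

lemma Proper.inj {s : Strands X} (h : s.Proper) {x y : X} (e : s.next x = s.next y) : x = y := by
  rw [← h.next_next x, e, h.next_next]

/-- All the endpoints that occur in a list of pairs. -/
def ends (l : List (X × X)) : List X := l.flatMap fun pq => [pq.1, pq.2]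

/-- The pairs consist of distinct endpoints, all present. -/
structure Fresh (s : Strands X) (l : List (X × X)) : Prop where
  nodup : (ends l).Nodup
  present : ∀ x ∈ ends l, s.next x ≠ x

lemma ends_cons (pq : X × X) (l : List (X × X)) : ends (pq :: l) = pq.1 :: pq.2 :: ends l := by
  simp [ends]

lemma ends_append (l l' : List (X × X)) : ends (l ++ l') = ends l ++ ends l' := by
  simp [ends]

/-- The map `f` identifies `s` with a part of `t`; `c` consists of the remaining loops of `t`. -/
structure Sim (f : X → Y) (c : Multiset (ℕ × ℕ)) (s : Strands X) (t : Strands Y) : Prop where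
  next : ∀ x, t.next (f x) = f (s.next x)
  word : ∀ x, t.word (f x) = s.word x
  loops : t.loops = s.loops + c

lemma Sim.trans {Z : Type} {f : X → Y} {g : Y → Z} {c d : Multiset (ℕ × ℕ)} {s : Strands X}
    {t : Strands Y} {u : Strands Z} (h : Sim f c s t) (h' : Sim g d t u) :
    Sim (g ∘ f) (c + d) s u :=
  ⟨fun x => by simp [h'.next, h.next], fun x => by simp [h'.word, h.word],
    by rw [h'.loops, h.loops, add_assoc]⟩

lemma Sim.unique {f : X → Y} (hf : Function.Injective f) {c : Multiset (ℕ × ℕ)} {s t : Strands X}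
    {u : Strands Y} (h : Sim f c s u) (h' : Sim f c t u) : s = t := by
  ext1
  · funext x
    exact hf (by rw [← h.next, h'.next])
  · funext x
    rw [← h.word, h'.word]
  · exact add_right_cancel (h.loops.symm.trans h'.loops)

variable [DecidableEq X] [DecidableEq Y]

lemma Proper.glue {s : Strands X} (h : s.Proper) {p q : X} (hp : s.next p ≠ p)
    (hq : s.next q ≠ q) (hpq : p ≠ q) : (s.glue p q).Proper := by
  have h1 := h.next_next
  have h2 := h.word_next
  constructor
  · intro x
    simp only [Strands.glue]
    grind
  · intro x
    simp only [Strands.glue]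
    grind [List.reverse_append, List.reverse_reverse]

lemma glue_present {s : Strands X} (h : s.Proper) {p q x : X} (hx : s.next x ≠ x) (hxp : x ≠ p)
    (hxq : x ≠ q) (hpq : p ≠ q) : (s.glue p q).next x ≠ x := by
  have h1 := h.next_next
  simp only [Strands.glue]
  grind

lemma glue_absent {s : Strands X} {p q x : X} (hx : s.next x = x) : (s.glue p q).next x = x := by
  simp only [Strands.glue]
  grind

lemma glue_comm {s : Strands X} (h : s.Proper) {p q r t : X} (hp : s.next p ≠ p)
    (hq : s.next q ≠ q) (hr : s.next r ≠ r) (ht : s.next t ≠ t) (hpr : p ≠ r)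
    (hpt : p ≠ t) (hqr : q ≠ r) (hqt : q ≠ t) (hpq : p ≠ q) (hrt : r ≠ t) :
    (s.glue p q).glue r t = (s.glue r t).glue p q := by
  have h1 := h.next_next
  have h2 := h.word_next
  ext1
  · funext x
    simp only [Strands.glue]
    grind
  · funext x
    simp only [Strands.glue]
    grind [List.append_assoc]
  · have e1 : s.next p = r → loopType (s.word r) = loopType (s.word p) := by
      intro e; rw [← e, h2, loopType_reverse]
    have e2 : s.next p = t → loopType (s.word t) = loopType (s.word p) := by
      intro e; rw [← e, h2, loopType_reverse]
    have e3 : s.next q = r → loopType (s.word r) = loopType (s.word q) := by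
      intro e; rw [← e, h2, loopType_reverse]
    have e4 : s.next q = t → loopType (s.word t) = loopType (s.word q) := by
      intro e; rw [← e, h2, loopType_reverse]
    have k1 : s.next r = p ↔ s.next p = r := by grind
    have k2 : s.next r = q ↔ s.next q = r := by grind
    have k3 : s.next t = p ↔ s.next p = t := by grind
    have k4 : s.next t = q ↔ s.next q = t := by grind
    have k5 : s.next q = p ↔ s.next p = q := by grind
    simp only [Strands.glue, hpr, hpt, hqr, hqt, hpr.symm, hpt.symm, hqr.symm, hqt.symm, or_self,
      if_false, k1, k2, k3, k4]
    by_cases c1 : s.next p = q <;> by_cases c2 : s.next r = t <;> by_cases c3 : s.next p = r <;>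
      by_cases c4 : s.next q = r <;> by_cases c5 : s.next p = t <;> by_cases c6 : s.next q = t <;>
      simp_all [loopType_append, add_comm, Multiset.cons_swap]

lemma gluePairs_cons (s : Strands X) (pq : X × X) (l : List (X × X)) :
    s.gluePairs (pq :: l) = (s.glue pq.1 pq.2).gluePairs l := rfl

lemma gluePairs_append (s : Strands X) (l l' : List (X × X)) :
    s.gluePairs (l ++ l') = (s.gluePairs l).gluePairs l' := by
  simp [gluePairs]

lemma Fresh.glue {s : Strands X} (h : s.Proper) {pq : X × X} {l : List (X × X)}
    (hf : s.Fresh (pq :: l)) :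
    (s.glue pq.1 pq.2).Proper ∧ (s.glue pq.1 pq.2).Fresh l := by
  obtain ⟨hn, hp⟩ := hf
  rw [ends_cons] at hn hp
  simp only [List.nodup_cons, List.mem_cons, not_or] at hn hp
  refine ⟨h.glue (hp _ (Or.inl rfl)) (hp _ (Or.inr (Or.inl rfl))) hn.1.1, hn.2.2, ?_⟩
  intro x hx
  refine glue_present h (hp _ (Or.inr (Or.inr hx))) ?_ ?_ hn.1.1
  · rintro rfl; exact hn.1.2 hx
  · rintro rfl; exact hn.2.1 hx

lemma gluePairs_proper {l : List (X × X)} : ∀ {s : Strands X}, s.Proper → s.Fresh l →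
    (s.gluePairs l).Proper := by
  induction l with
  | nil => intro s h _; exact h
  | cons pq l ih =>
    intro s h hf
    exact ih (hf.glue h).1 (hf.glue h).2

lemma gluePairs_present {l : List (X × X)} {x : X} (hxl : x ∉ ends l) :
    ∀ {s : Strands X}, s.Proper → s.Fresh l → s.next x ≠ x → (s.gluePairs l).next x ≠ x := by
  induction l with
  | nil => intro s _ _ hx; exact hx
  | cons pq l ih =>
    intro s h hf hx
    rw [ends_cons] at hxl
    simp only [List.mem_cons, not_or] at hxl
    have hn := hf.nodup
    rw [ends_cons] at hn
    simp only [List.nodup_cons, List.mem_cons, not_or] at hn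
    exact ih hxl.2.2 (hf.glue h).1 (hf.glue h).2 (glue_present h hx hxl.1 hxl.2.1 hn.1.1)

lemma gluePairs_absent {l : List (X × X)} {x : X} :
    ∀ {s : Strands X}, s.next x = x → (s.gluePairs l).next x = x := by
  induction l with
  | nil => intro s hx; exact hx
  | cons pq l ih => intro s hx; exact ih (glue_absent hx)

lemma gluePairs_absent_of_mem {l : List (X × X)} {x : X} (hx : x ∈ ends l) :
    ∀ {s : Strands X}, (s.gluePairs l).next x = x := by
  induction l with
  | nil => simp [ends] at hx
  | cons pq l ih =>
    intro s
    rw [ends_cons] at hx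
    simp only [List.mem_cons] at hx
    rw [gluePairs_cons]
    rcases hx with hx | hx | hx
    · exact gluePairs_absent (by simp [Strands.glue, hx])
    · exact gluePairs_absent (by simp [Strands.glue, hx])
    · exact ih hx

lemma gluePairs_glue {pq : X × X} {l : List (X × X)} : ∀ {s : Strands X}, s.Proper →
    s.Fresh (pq :: l) → (s.glue pq.1 pq.2).gluePairs l = (s.gluePairs l).glue pq.1 pq.2 := by
  induction l with
  | nil => intro s _ _; rfl
  | cons rt l ih =>
    intro s h hf
    have hn := hf.nodup
    have hp := hf.present
    rw [ends_cons, ends_cons] at hn hp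
    have hf' : s.Fresh (rt :: pq :: l) := by
      constructor
      · rw [ends_cons, ends_cons]
        grind
      · intro x hx
        apply hp
        rw [ends_cons, ends_cons] at hx
        grind
    simp only [List.nodup_cons, List.mem_cons, not_or] at hn
    rw [gluePairs_cons, gluePairs_cons, ← ih (hf'.glue h).1 (hf'.glue h).2]
    congr 1
    apply glue_comm h <;> first | (apply hp; simp; done) | grind

lemma gluePairs_comm {l l' : List (X × X)} : ∀ {s : Strands X}, s.Proper →
    s.Fresh (l ++ l') → (s.gluePairs l).gluePairs l' = (s.gluePairs l').gluePairs l := by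
  induction l with
  | nil => intro s _ _; rfl
  | cons pq l ih =>
    intro s h hf
    have hf' := hf.glue (pq := pq) (l := l ++ l') h
    rw [gluePairs_cons, ih hf'.1 hf'.2, gluePairs_cons, gluePairs_glue h]
    have hn := hf.nodup
    have hp := hf.present
    rw [List.cons_append, ends_cons, ends_append] at hn hp
    constructor
    · rw [ends_cons]
      grind
    · intro x hx
      apply hp
      rw [ends_cons] at hx
      grind

lemma Sim.glue {f : X → Y} (hf : Function.Injective f) {c : Multiset (ℕ × ℕ)} {s : Strands X}
    {t : Strands Y} (h : Sim f c s t) (p q : X) : Sim f c (s.glue p q) (t.glue (f p) (f q)) := by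
  obtain ⟨h1, h2, h3⟩ := h
  constructor
  · intro x
    simp only [Strands.glue, h1, hf.eq_iff]
    split_ifs <;> rfl
  · intro x
    simp only [Strands.glue, h1, h2, hf.eq_iff]
  · simp only [Strands.glue, h1, h2, h3, hf.eq_iff]
    split_ifs <;> simp

lemma Sim.gluePairs {f : X → Y} (hf : Function.Injective f) {c : Multiset (ℕ × ℕ)}
    {l : List (X × X)} : ∀ {s : Strands X} {t : Strands Y}, Sim f c s t →
    Sim f c (s.gluePairs l) (t.gluePairs (l.map (Prod.map f f))) := by
  induction l with
  | nil => intro s t h; exact h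
  | cons pq l ih => intro s t h; exact ih (h.glue hf pq.1 pq.2)

end Strands

open Strands

lemma outer_injective {n : ℕ} : Function.Injective (outer (n := n)) := by
  rintro (i | i) (j | j) h <;> simp_all [outer]

lemma mem_ends_seam {n : ℕ} (x : Point n ⊕ Point n) :
    x ∈ ends (seam n) ↔ ∃ i, x = Sum.inl (Sum.inr i) ∨ x = Sum.inr (Sum.inl i) := by
  simp [ends, seam, eq_comm]

lemma outer_not_mem {n : ℕ} (x : Point n) : outer x ∉ ends (seam n) := by
  rw [mem_ends_seam]
  rcases x with i | i <;> simp [outer]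

lemma mem_ends_or_outer {n : ℕ} (x : Point n ⊕ Point n) :
    x ∈ ends (seam n) ∨ outer (Sum.elim id id x) = x := by
  rw [mem_ends_seam]
  rcases x with (i | i) | (i | i) <;> simp [outer]

lemma nodup_ends_map {X ι : Type} [DecidableEq X] (f g : ι → X) (l : List ι) (hl : l.Nodup)
    (hf : Function.Injective f) (hg : Function.Injective g) (hfg : ∀ i j, f i ≠ g j) :
    (ends (l.map fun i => (f i, g i))).Nodup := by
  induction l with
  | nil => simp [ends]
  | cons i l ih =>
    rw [List.map_cons, ends_cons]
    have := ih hl.of_cons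
    have hi : i ∉ l := (List.nodup_cons.mp hl).1
    have hm : ∀ x, x ∈ ends (l.map fun i => (f i, g i)) ↔ ∃ j ∈ l, x = f j ∨ x = g j := by
      simp [ends]
    simp only [List.nodup_cons, List.mem_cons, hm, this, and_true, not_or]
    refine ⟨⟨hfg _ _, ?_⟩, ?_⟩
    · rintro ⟨j, hj, h | h⟩
      · exact hi (hf h ▸ hj)
      · exact hfg _ _ h
    · rintro ⟨j, hj, h | h⟩
      · exact hfg _ _ h.symm
      · exact hi (hg h ▸ hj)

lemma seam_nodup (n : ℕ) : (ends (seam n)).Nodup := by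
  apply nodup_ends_map _ _ _ (List.nodup_finRange n)
  · intro i j h; simpa using h
  · intro i j h; simpa using h
  · intro i j h; simp at h

lemma Strands.Proper.juxt {X Y : Type} {s : Strands X} {t : Strands Y} (hs : s.Proper)
    (ht : t.Proper) : (s.juxt t).Proper := by
  constructor
  · rintro (x | x) <;> simp [Strands.juxt, hs.next_next, ht.next_next]
  · rintro (x | x) <;> simp [Strands.juxt, hs.word_next, ht.word_next]

namespace Diagram
variable {n : ℕ}

lemma proper (d : Diagram n) : d.toStrands.Proper := ⟨d.next_next, d.word_next⟩

lemma juxt_ne (d d' : Diagram n) (x : Point n ⊕ Point n) :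
    (d.toStrands.juxt d'.toStrands).next x ≠ x := by
  rcases x with x | x <;> simp [Strands.juxt, d.next_ne, d'.next_ne]

lemma fresh (d d' : Diagram n) : (d.toStrands.juxt d'.toStrands).Fresh (seam n) :=
  ⟨seam_nodup n, fun x _ => juxt_ne d d' x⟩

lemma outer_next (d d' : Diagram n) (x : Point n) :
    ((d.toStrands.juxt d'.toStrands).gluePairs (seam n)).next (outer x) =
      outer ((d.toStrands.concat d'.toStrands).next x) := by
  have hP := gluePairs_proper (d.proper.juxt d'.proper) (fresh d d')
  rcases mem_ends_or_outer
    (((d.toStrands.juxt d'.toStrands).gluePairs (seam n)).next (outer x)) with h | h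
  · have h' := gluePairs_absent_of_mem h (s := d.toStrands.juxt d'.toStrands)
    rw [hP.next_next] at h'
    exact absurd (h' ▸ h) (outer_not_mem x)
  · exact h.symm

lemma sim_outer (d d' : Diagram n) : Sim outer 0 (d.toStrands.concat d'.toStrands)
    ((d.toStrands.juxt d'.toStrands).gluePairs (seam n)) :=
  ⟨outer_next d d', fun _ => rfl, by simp [Strands.concat]⟩

/-- Multiplication is concatenation, the first factor on top. -/
instance : Mul (Diagram n) where
  mul d d' :=
    { d.toStrands.concat d'.toStrands with
      next_next := fun x => outer_injective (by
        rw [← outer_next, ← outer_next]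
        exact (gluePairs_proper (d.proper.juxt d'.proper) (fresh d d')).next_next _)
      next_ne := fun x h => by
        have := gluePairs_present (outer_not_mem x) (d.proper.juxt d'.proper) (fresh d d')
          (juxt_ne d d' _)
        rw [outer_next, h] at this
        exact this rfl
      word_next := fun x => by
        have := (gluePairs_proper (d.proper.juxt d'.proper) (fresh d d')).word_next (outer x)
        rw [outer_next] at this
        exact this }

lemma mul_toStrands (d d' : Diagram n) :
    (d * d').toStrands = d.toStrands.concat d'.toStrands := rfl

/-- The identity diagram: vertical strands without blobs, no loops. -/
instance : One (Diagram n) where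
  one :=
    { next := Sum.swap
      word := fun _ => []
      loops := 0
      next_next := by rintro (x | x) <;> rfl
      next_ne := by rintro (x | x) <;> simp
      word_next := fun _ => rfl }

lemma ext' {d d' : Diagram n} (h : d.toStrands = d'.toStrands) : d = d' := by
  cases d; cases d'; cases h; rfl

/-- The endpoints of three diagrams. -/
abbrev P3 (n : ℕ) : Type := Point n ⊕ (Point n ⊕ Point n)

/-- The seam between the first two of three diagrams. -/
def seam12 (n : ℕ) : List (P3 n × P3 n) :=
  (List.finRange n).map fun i => (Sum.inl (Sum.inr i), Sum.inr (Sum.inl (Sum.inl i)))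

/-- The seam between the last two of three diagrams. -/
def seam23 (n : ℕ) : List (P3 n × P3 n) :=
  (List.finRange n).map fun i => (Sum.inr (Sum.inl (Sum.inr i)), Sum.inr (Sum.inr (Sum.inl i)))

/-- The endpoints left after gluing the first seam. -/
def outer12 : Point n ⊕ Point n → P3 n
  | Sum.inl (Sum.inl i) => Sum.inl (Sum.inl i)
  | Sum.inl (Sum.inr i) => Sum.inr (Sum.inl (Sum.inr i))
  | Sum.inr x => Sum.inr (Sum.inr x)

/-- The endpoints left after gluing the second seam. -/
def outer23 : Point n ⊕ Point n → P3 n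
  | Sum.inl x => Sum.inl x
  | Sum.inr (Sum.inl i) => Sum.inr (Sum.inl (Sum.inl i))
  | Sum.inr (Sum.inr i) => Sum.inr (Sum.inr (Sum.inr i))

/-- The endpoints of the first two diagrams. -/
def incl12 : Point n ⊕ Point n → P3 n
  | Sum.inl x => Sum.inl x
  | Sum.inr x => Sum.inr (Sum.inl x)

lemma outer12_injective : Function.Injective (outer12 (n := n)) := by
  rintro ((i | i) | (i | i)) ((j | j) | (j | j)) h <;> simp_all [outer12]

lemma outer23_injective : Function.Injective (outer23 (n := n)) := by
  rintro ((i | i) | (i | i)) ((j | j) | (j | j)) h <;> simp_all [outer23]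

lemma incl12_injective : Function.Injective (incl12 (n := n)) := by
  rintro (x | x) (y | y) h <;> simp_all [incl12]

lemma gluePairs_off {X : Type} [DecidableEq X] {l : List (X × X)} {x : X} :
    ∀ {s : Strands X}, s.Proper → s.Fresh l → x ∉ ends l → (∀ y ∈ ends l, s.next y ≠ x) →
    (s.gluePairs l).next x = s.next x ∧ (s.gluePairs l).word x = s.word x := by
  induction l with
  | nil => intro s _ _ _ _; exact ⟨rfl, rfl⟩
  | cons pq l ih =>
    intro s h hf hx hy
    have hf' := hf.glue h
    rw [ends_cons] at hx hy
    simp only [List.mem_cons, not_or] at hx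
    have h1 := hy pq.1 (by simp)
    have h2 := hy pq.2 (by simp)
    have h1' : s.next x ≠ pq.1 := fun e => h1 (by rw [← e, h.next_next])
    have h2' : s.next x ≠ pq.2 := fun e => h2 (by rw [← e, h.next_next])
    have e1 : (s.glue pq.1 pq.2).next x = s.next x := by
      simp [Strands.glue, hx.1, hx.2.1, h1', h2']
    have e2 : (s.glue pq.1 pq.2).word x = s.word x := by
      simp [Strands.glue, hx.1, hx.2.1, h1', h2']
    have := ih hf'.1 hf'.2 hx.2.2 (by
      intro y hyl e
      have : y = s.next x := by
        rw [← e1, ← e, hf'.1.next_next]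
      exact hy y (by simp [hyl]) (by rw [this, h.next_next]))
    rw [gluePairs_cons, this.1, this.2, e1, e2]
    exact ⟨rfl, rfl⟩

lemma mem_seam12 (x : P3 n) : x ∈ ends (seam12 n) ↔
    ∃ i, x = Sum.inl (Sum.inr i) ∨ x = Sum.inr (Sum.inl (Sum.inl i)) := by
  simp [ends, seam12, eq_comm]

lemma mem_seam23 (x : P3 n) : x ∈ ends (seam23 n) ↔
    ∃ i, x = Sum.inr (Sum.inl (Sum.inr i)) ∨ x = Sum.inr (Sum.inr (Sum.inl i)) := by
  simp [ends, seam23, eq_comm]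

lemma seam_map_outer12 : (seam n).map (Prod.map outer12 outer12) = seam23 n := by
  simp [seam, seam23, outer12]

lemma seam_map_outer23 : (seam n).map (Prod.map outer23 outer23) = seam12 n := by
  simp [seam, seam12, outer23]

lemma seam_map_incl12 : (seam n).map (Prod.map incl12 incl12) = seam12 n := by
  simp [seam, seam12, incl12]

lemma seam_map_inr : (seam n).map (Prod.map Sum.inr Sum.inr) = seam23 n := by
  simp [seam, seam23]

/-- Three diagrams side by side. -/
def tri (a b c : Diagram n) : Strands (P3 n) :=
  a.toStrands.juxt (b.toStrands.juxt c.toStrands)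

lemma tri_proper (a b c : Diagram n) : (tri a b c).Proper :=
  a.proper.juxt (b.proper.juxt c.proper)

lemma tri_ne (a b c : Diagram n) (x : P3 n) : (tri a b c).next x ≠ x := by
  rcases x with x | x | x <;> simp [tri, Strands.juxt, a.next_ne, b.next_ne, c.next_ne]

lemma tri_fresh (a b c : Diagram n) : (tri a b c).Fresh (seam12 n ++ seam23 n) := by
  refine ⟨?_, fun x _ => tri_ne a b c x⟩
  rw [ends_append, List.nodup_append]
  refine ⟨?_, ?_, ?_⟩
  · apply nodup_ends_map _ _ _ (List.nodup_finRange n)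
    · intro i j h; simpa using h
    · intro i j h; simpa using h
    · intro i j h; simp at h
  · apply nodup_ends_map _ _ _ (List.nodup_finRange n)
    · intro i j h; simpa using h
    · intro i j h; simpa using h
    · intro i j h; simp at h
  · intro x hx y hy
    rw [mem_seam12] at hx
    rw [mem_seam23] at hy
    grind

lemma tri_fresh12 (a b c : Diagram n) : (tri a b c).Fresh (seam12 n) := by
  refine ⟨?_, fun x _ => tri_ne a b c x⟩
  have := (tri_fresh a b c).nodup
  rw [ends_append] at this
  exact this.of_append_left

lemma tri_fresh23 (a b c : Diagram n) : (tri a b c).Fresh (seam23 n) := by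
  refine ⟨?_, fun x _ => tri_ne a b c x⟩
  have := (tri_fresh a b c).nodup
  rw [ends_append] at this
  exact this.of_append_right

lemma sim12 (a b c : Diagram n) :
    Sim outer12 0 ((a * b).toStrands.juxt c.toStrands) ((tri a b c).gluePairs (seam12 n)) := by
  have h0 : Sim incl12 c.loops (a.toStrands.juxt b.toStrands) (tri a b c) := by
    constructor
    · rintro (x | x) <;> simp [incl12, tri, Strands.juxt]
    · rintro (x | x) <;> simp [incl12, tri, Strands.juxt]
    · simp [tri, Strands.juxt, add_assoc]
  have h1 := h0.gluePairs incl12_injective (l := seam n)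
  rw [seam_map_incl12] at h1
  have h2 := (sim_outer a b).trans h1
  have hc : ∀ x, ((tri a b c).gluePairs (seam12 n)).next (Sum.inr (Sum.inr x)) =
      Sum.inr (Sum.inr (c.next x)) ∧
      ((tri a b c).gluePairs (seam12 n)).word (Sum.inr (Sum.inr x)) = c.word x := by
    intro x
    refine gluePairs_off (tri_proper a b c) (tri_fresh12 a b c) ?_ ?_
    · rw [mem_seam12]; simp
    · intro y hy
      rw [mem_seam12] at hy
      obtain ⟨i, rfl | rfl⟩ := hy <;> simp [tri, Strands.juxt]
  have hf : ∀ x, outer12 (Sum.inl x : Point n ⊕ Point n) = incl12 (outer x) := by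
    rintro (x | x) <;> rfl
  constructor
  · rintro (x | x)
    · rw [hf]
      refine (h2.next x).trans ?_
      simp [Strands.juxt, hf, mul_toStrands]
    · exact (hc x).1
  · rintro (x | x)
    · rw [hf]
      exact h2.word x
    · exact (hc x).2
  · rw [h2.loops]
    simp [Strands.juxt, mul_toStrands]

lemma sim23 (a b c : Diagram n) :
    Sim outer23 0 (a.toStrands.juxt (b * c).toStrands) ((tri a b c).gluePairs (seam23 n)) := by
  have h0 : Sim Sum.inr a.loops (b.toStrands.juxt c.toStrands) (tri a b c) := by
    constructor
    · rintro (x | x) <;> simp [tri, Strands.juxt]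
    · rintro (x | x) <;> simp [tri, Strands.juxt]
    · simp [tri, Strands.juxt, add_comm]
  have h1 := h0.gluePairs Sum.inr_injective (l := seam n)
  rw [seam_map_inr] at h1
  have h2 := (sim_outer b c).trans h1
  have hc : ∀ x, ((tri a b c).gluePairs (seam23 n)).next (Sum.inl x) =
      Sum.inl (a.next x) ∧
      ((tri a b c).gluePairs (seam23 n)).word (Sum.inl x) = a.word x := by
    intro x
    refine gluePairs_off (tri_proper a b c) (tri_fresh23 a b c) ?_ ?_
    · rw [mem_seam23]; simp
    · intro y hy
      rw [mem_seam23] at hy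
      obtain ⟨i, rfl | rfl⟩ := hy <;> simp [tri, Strands.juxt]
  have hf : ∀ x, outer23 (Sum.inr x : Point n ⊕ Point n) = Sum.inr (outer x) := by
    rintro (x | x) <;> rfl
  constructor
  · rintro (x | x)
    · exact (hc x).1
    · rw [hf]
      refine (h2.next x).trans ?_
      simp [Strands.juxt, hf, mul_toStrands]
  · rintro (x | x)
    · exact (hc x).2
    · rw [hf]
      exact h2.word x
  · rw [h2.loops]
    simp [Strands.juxt, mul_toStrands, add_comm]

lemma mul_assoc' (a b c : Diagram n) : a * b * c = a * (b * c) := by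
  have h1 := (sim12 a b c).gluePairs outer12_injective (l := seam n)
  rw [seam_map_outer12] at h1
  have h2 := (sim23 a b c).gluePairs outer23_injective (l := seam n)
  rw [seam_map_outer23, ← gluePairs_comm (tri_proper a b c) (tri_fresh a b c)] at h2
  have h1' := (sim_outer (a * b) c).trans h1
  have h2' := (sim_outer a (b * c)).trans h2
  have hf : outer12 (n := n) ∘ outer = outer23 ∘ outer := by
    funext x
    rcases x with x | x <;> rfl
  rw [hf] at h1'
  exact ext' (h1'.unique (outer23_injective.comp outer_injective) h2')

lemma glue_symm {X : Type} [DecidableEq X] {s : Strands X} (h : s.Proper) {p q : X}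
    (hpq : p ≠ q) : s.glue p q = s.glue q p := by
  have h1 := h.next_next
  have h2 := h.word_next
  have k : s.next q = p ↔ s.next p = q := by grind
  ext1
  · funext x
    simp only [Strands.glue]
    grind
  · funext x
    simp only [Strands.glue]
    grind
  · simp only [Strands.glue, k]
    split_ifs with e
    · rw [← e, h2, loopType_reverse]
    · rfl

lemma gluePairs_symm {X ι : Type} [DecidableEq X] (p q : ι → X) (l : List ι) :
    ∀ {s : Strands X}, s.Proper → s.Fresh (l.map fun i => (p i, q i)) →
    s.gluePairs (l.map fun i => (p i, q i)) = s.gluePairs (l.map fun i => (q i, p i)) := by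
  induction l with
  | nil => intro s _ _; rfl
  | cons i l ih =>
    intro s h hf
    have hn := hf.nodup
    rw [List.map_cons, ends_cons] at hn
    simp only [List.nodup_cons, List.mem_cons, not_or] at hn
    rw [List.map_cons] at hf
    have hf' := hf.glue h
    rw [List.map_cons, List.map_cons, gluePairs_cons, gluePairs_cons, ih hf'.1 hf'.2]
    simp only [glue_symm h hn.1.1]

lemma straighten {X Y ι : Type} [DecidableEq Y] [DecidableEq X] (d : Strands X)
    (hd : ∀ x, d.next x ≠ x) (u : ι → X)
    (a p q : ι → Y) (hu : Function.Injective u) (l : List ι) : ∀ (f : X → Y) (s : Strands Y),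
    s.Proper → s.Fresh (l.map fun i => (p i, q i)) → Sim f 0 d s → Function.Injective f →
    (∀ i ∈ l, f (u i) = q i) → (∀ i ∈ l, ∀ x, f x ≠ p i ∧ f x ≠ a i) →
    (∀ i ∈ l, s.next (a i) = p i ∧ s.word (a i) = []) → Function.Injective a →
    (∀ i j, a i ≠ p j) → (∀ i j, a i ≠ q j) →
    ∃ f' : X → Y, Sim f' 0 d (s.gluePairs (l.map fun i => (p i, q i))) ∧
      (∀ i ∈ l, f' (u i) = a i) ∧ (∀ x, (∀ i ∈ l, x ≠ u i) → f' x = f x) := by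
  induction l with
  | nil => 
    intro f s _ _ h _ _ _ _ _ _ _
    exact ⟨f, h, by simp, by simp⟩
  | cons i l ih =>
    intro f s h hF hs hf hq hp ha hai hap haq
    rw [List.map_cons] at hF
    have hn := hF.nodup
    rw [ends_cons] at hn
    simp only [List.nodup_cons, List.mem_cons, not_or] at hn
    have hF' := hF.glue h
    have hm : ∀ j ∈ l, p j ∈ ends (l.map fun i => (p i, q i)) ∧
        q j ∈ ends (l.map fun i => (p i, q i)) := by
      intro j hj
      simp only [ends, List.mem_flatMap, List.mem_map]
      exact ⟨⟨_, ⟨j, hj, rfl⟩, by simp⟩, ⟨_, ⟨j, hj, rfl⟩, by simp⟩⟩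
    have hil : ∀ j ∈ l, p j ≠ p i ∧ p j ≠ q i ∧ q j ≠ p i ∧ q j ≠ q i := by
      intro j hj
      refine ⟨?_, ?_, ?_, ?_⟩ <;> intro e
      · exact hn.1.2 (e ▸ (hm j hj).1)
      · exact hn.2.1 (e ▸ (hm j hj).1)
      · exact hn.1.2 (e ▸ (hm j hj).2)
      · exact hn.2.1 (e ▸ (hm j hj).2)
    have hi : i ∉ l := fun hi => (hil i hi).1 rfl
    have hnp : s.next (p i) = a i := by
      rw [← (ha i (by simp)).1, h.next_next]
    have hwp : s.word (p i) = [] := by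
      rw [← (ha i (by simp)).1, h.word_next, (ha i (by simp)).2]; rfl
    have hwa := (ha i (by simp)).2
    have hna := (ha i (by simp)).1
    have hqi := hq i (by simp)
    have hpi := hp i (by simp)
    have g1 : Sim (Function.update f (u i) (a i)) 0 d (s.glue (p i) (q i)) := by
      refine ⟨?_, ?_, ?_⟩
      · intro x
        by_cases hx : x = u i
        · subst hx
          rw [Function.update_self, Function.update_of_ne (hd _)]
          have e : s.next (q i) = f (d.next (u i)) := by rw [← hqi, hs.next]
          simp [Strands.glue, hap, haq, hna, e]
        · rw [Function.update_of_ne hx]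
          have hx' : f x ≠ q i := fun e => hx (hf (e.trans hqi.symm))
          by_cases hx2 : d.next x = u i
          · rw [hx2, Function.update_self]
            have e : s.next (f x) = q i := by rw [hs.next, hx2, hqi]
            simp [Strands.glue, (hpi x).1, hx', e, hnp, Ne.symm hn.1.1]
          · rw [Function.update_of_ne hx2]
            have hx3 : f (d.next x) ≠ q i := fun e => hx2 (hf (e.trans hqi.symm))
            simp [Strands.glue, (hpi _).1, hx', hs.next, hx3]
      · intro x
        by_cases hx : x = u i
        · subst hx
          rw [Function.update_self]
          have e : s.word (q i) = d.word (u i) := by rw [← hqi, hs.word]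
          simp [Strands.glue, hap, haq, hna, hwa, e]
        · rw [Function.update_of_ne hx]
          have hx' : f x ≠ q i := fun e => hx (hf (e.trans hqi.symm))
          simp [Strands.glue, (hpi _).1, hx', hs.next, hs.word, hwp]
      · simp [Strands.glue, hnp, haq, hs.loops]
    have g2 : Function.Injective (Function.update f (u i) (a i)) := by
      intro x y e
      by_cases hx : x = u i <;> by_cases hy : y = u i
      · rw [hx, hy]
      · subst hx
        rw [Function.update_self, Function.update_of_ne hy] at e
        exact absurd e.symm (hpi y).2
      · subst hy
        rw [Function.update_self, Function.update_of_ne hx] at e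
        exact absurd e (hpi x).2
      · rw [Function.update_of_ne hx, Function.update_of_ne hy] at e
        exact hf e
    have g3 : ∀ j ∈ l, Function.update f (u i) (a i) (u j) = q j := by
      intro j hj
      rw [Function.update_of_ne]
      · exact hq j (by simp [hj])
      · intro e
        exact hi (hu e ▸ hj)
    have g4 : ∀ j ∈ l, ∀ x, Function.update f (u i) (a i) x ≠ p j ∧ Function.update f (u i) (a i) x ≠ a j := by
      intro j hj x
      by_cases hx : x = u i
      · subst hx
        rw [Function.update_self]
        exact ⟨hap i j, fun e => hi (hai e ▸ hj)⟩
      · rw [Function.update_of_ne hx]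
        exact hp j (by simp [hj]) x
    have g5 : ∀ j ∈ l, (s.glue (p i) (q i)).next (a j) = p j ∧ (s.glue (p i) (q i)).word (a j) = [] := by
      intro j hj
      have h5 := ha j (by simp [hj])
      have h6 := hil j hj
      simp [Strands.glue, hap, haq, h5.1, h5.2, h6.1, h6.2.1]
    obtain ⟨f', h1, h2, h3⟩ := ih _ _ hF'.1 hF'.2 g1 g2 g3 g4 g5 hai hap haq
    refine ⟨f', h1, ?_, ?_⟩
    · intro j hj
      rcases List.mem_cons.mp hj with rfl | hj
      · rw [h3]
        · simp
        · rintro j' hj' e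
          exact hi (hu e ▸ hj')
      · exact h2 j hj
    · intro x hx
      rw [h3 x fun j hj => hx j (by simp [hj]), Function.update_of_ne (hx i (by simp))]

lemma one_loops : (1 : Diagram n).loops = 0 := rfl

lemma one_mul' (d : Diagram n) : 1 * d = d := by
  obtain ⟨f', h1, h2, h3⟩ := straighten d.toStrands d.next_ne (Sum.inl : Fin n → Point n)
    (fun i => (Sum.inl (Sum.inl i) : Point n ⊕ Point n)) (fun i => Sum.inl (Sum.inr i))
    (fun i => Sum.inr (Sum.inl i)) Sum.inl_injective (List.finRange n) Sum.inr
    ((1 : Diagram n).toStrands.juxt d.toStrands) ((1 : Diagram n).proper.juxt d.proper)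
    (fresh 1 d) ⟨fun _ => rfl, fun _ => rfl, by simp [Strands.juxt, one_loops]⟩
    Sum.inr_injective (fun _ _ => rfl) (by simp) (fun _ _ => ⟨rfl, rfl⟩)
    (fun i j h => by simpa using h) (by simp) (by simp)
  have hf : f' = outer := by
    funext x
    rcases x with x | x
    · exact h2 x (List.mem_finRange x)
    · exact h3 _ (by simp)
  rw [hf] at h1
  exact ext' ((sim_outer 1 d).unique outer_injective h1)

lemma mul_one' (d : Diagram n) : d * 1 = d := by
  have hF := fresh d 1
  have hF2 : (d.toStrands.juxt (1 : Diagram n).toStrands).Fresh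
      ((List.finRange n).map fun i => (Sum.inr (Sum.inl i), Sum.inl (Sum.inr i))) := by
    refine ⟨?_, fun x _ => juxt_ne _ _ _⟩
    apply nodup_ends_map _ _ _ (List.nodup_finRange n)
    · intro i j h; simpa using h
    · intro i j h; simpa using h
    · intro i j h; simp at h
  obtain ⟨f', h1, h2, h3⟩ := straighten d.toStrands d.next_ne (Sum.inr : Fin n → Point n)
    (fun i => (Sum.inr (Sum.inr i) : Point n ⊕ Point n)) (fun i => Sum.inr (Sum.inl i))
    (fun i => Sum.inl (Sum.inr i)) Sum.inr_injective (List.finRange n) Sum.inl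
    (d.toStrands.juxt (1 : Diagram n).toStrands) (d.proper.juxt (1 : Diagram n).proper)
    hF2 ⟨fun _ => rfl, fun _ => rfl, by simp [Strands.juxt, one_loops]⟩
    Sum.inl_injective (fun _ _ => rfl) (by simp) (fun _ _ => ⟨rfl, rfl⟩)
    (fun i j h => by simpa using h) (by simp) (by simp)
  have hf : f' = outer := by
    funext x
    rcases x with x | x
    · exact h3 _ (by simp)
    · exact h2 x (List.mem_finRange x)
  rw [hf, gluePairs_symm _ _ _ (d.proper.juxt (1 : Diagram n).proper) hF2] at h1
  exact ext' ((sim_outer d 1).unique outer_injective h1)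

instance : Monoid (Diagram n) where
  mul_assoc := mul_assoc'
  one_mul := one_mul'
  mul_one := mul_one'

end Diagram

namespace Strands
variable {X : Type}

lemma Reaches.next {pos : X → ℕ} {s : Strands X} (h : s.Proper) (hp : Planar pos s) {z : ℕ} {x : X}
    (hr : Reaches pos s z x) : Reaches pos s z (s.next x) := by
  intro c h1 h2 h3
  rw [h.next_next] at h2
  rw [hr c h2 h1 h3]
  refine hp c x h2.symm ?_
  rintro rfl
  exact h1 (h.next_next c).symm

variable [DecidableEq X]

lemma glue_planar {pos : X → ℕ} (hpos : Function.Injective pos) {s : Strands X} (h : s.Proper)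
    (hp : Planar pos s) {p q : X} (hpq : pos p < pos q)
    (hadj : ∀ c, s.next c ≠ c → ¬ (pos p < pos c ∧ pos c < pos q)) :
    Planar pos (s.glue p q) := by
  have h1 := h.next_next
  intro c x hxc hxc'
  by_cases hc0 : s.next c = c
  · have := glue_absent (p := p) (q := q) hc0
    rw [this]; omega
  by_cases hx0 : s.next x = x
  · have := glue_absent (p := p) (q := q) hx0
    rw [this]
  by_cases hcp : c = p
  · have : (s.glue p q).next c = c := by simp [Strands.glue, hcp]
    rw [this]; omega
  by_cases hcq : c = q
  · have : (s.glue p q).next c = c := by simp [Strands.glue, hcq]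
    rw [this]; omega
  by_cases hxp : x = p
  · have : (s.glue p q).next x = x := by simp [Strands.glue, hxp]
    rw [this]
  by_cases hxq : x = q
  · have : (s.glue p q).next x = x := by simp [Strands.glue, hxq]
    rw [this]
  have hne : ∀ a b : X, a ≠ b → pos a ≠ pos b := fun a b e e' => e (hpos e')
  have ac := hadj c hc0
  have ax := hadj x hx0
  have ac' := hadj (s.next c) (by rw [h1]; exact fun e => hc0 e.symm)
  have ax' := hadj (s.next x) (by rw [h1]; exact fun e => hx0 e.symm)
  have b1 := hne _ _ hcp
  have b2 := hne _ _ hcq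
  have b3 := hne _ _ hxp
  have b4 := hne _ _ hxq
  have b5 := hne _ _ hxc
  simp only [Strands.glue, hcp, hcq, hxp, hxq, or_self, if_false] at hxc' ⊢
  by_cases c1 : s.next c = p
  · have e1 : s.next p = c := by rw [← c1, h1]
    simp only [c1, if_true] at hxc' ⊢
    have n1 : s.next x ≠ p := fun e => hxc (by rw [← e1, ← e, h1])
    have n2 : s.next x ≠ q := fun e => hxc' (by rw [← e, h1])
    simp only [n1, n2, if_false]
    have i1 := hp c x hxc (by rw [c1]; exact hxp)
    have i2 := hp p x hxp (by rw [e1]; exact hxc)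
    have i3 := hp q x hxq hxc'
    have i4 := hp (s.next q) x hxc' (by rw [h1]; exact hxq)
    rw [h1] at i4
    rw [c1] at i1
    rw [e1] at i2
    have j1 := hne _ _ n1
    have j2 := hne _ _ n2
    have j3 := hne _ _ hxc'
    have j4 : pos (s.next x) ≠ pos (s.next q) := hne _ _ fun e => hxq (h.inj e)
    have j5 : pos (s.next x) ≠ pos c := hne _ _ fun e => hxp (by rw [← c1, ← e, h1])
    by_cases hq0 : s.next q = q
    · rw [hq0] at *
      omega
    have a5 := hadj (s.next q) (by rw [h1]; exact fun e => hq0 e.symm)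
    omega
  by_cases c2 : s.next c = q
  · have e1 : s.next q = c := by rw [← c2, h1]
    rw [if_neg c1, if_pos c2] at hxc' ⊢
    have n1 : s.next x ≠ q := fun e => hxc (by rw [← e1, ← e, h1])
    have n2 : s.next x ≠ p := fun e => hxc' (by rw [← e, h1])
    simp only [n1, n2, if_false]
    have i1 := hp c x hxc (by rw [c2]; exact hxq)
    have i2 := hp q x hxq (by rw [e1]; exact hxc)
    have i3 := hp p x hxp hxc'
    have i4 := hp (s.next p) x hxc' (by rw [h1]; exact hxp)
    rw [h1] at i4
    rw [c2] at i1
    rw [e1] at i2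
    have j1 := hne _ _ n1
    have j2 := hne _ _ n2
    have j3 := hne _ _ hxc'
    have j4 : pos (s.next x) ≠ pos (s.next p) := hne _ _ fun e => hxp (h.inj e)
    have j5 : pos (s.next x) ≠ pos c := hne _ _ fun e => hxq (by rw [← c2, ← e, h1])
    by_cases hq0 : s.next p = p
    · rw [hq0] at *
      omega
    have a5 := hadj (s.next p) (by rw [h1]; exact fun e => hq0 e.symm)
    omega
  rw [if_neg c1, if_neg c2] at hxc' ⊢
  have i0 := hp c x hxc hxc'
  have hpp : p ≠ s.next c := fun e => c1 e.symm
  have hqq : q ≠ s.next c := fun e => c2 e.symm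
  have i1 := hp c p (Ne.symm hcp) hpp
  have i2 := hp c q (Ne.symm hcq) hqq
  have k1 := hne _ _ hpp
  have k2 := hne _ _ hqq
  by_cases c3 : s.next x = p
  · rw [if_pos c3]
    rw [c3] at i0
    omega
  by_cases c4 : s.next x = q
  · rw [if_neg c3, if_pos c4]
    rw [c4] at i0
    omega
  rw [if_neg c3, if_neg c4]
  exact i0

lemma glue_reaches {pos : X → ℕ} (hpos : Function.Injective pos) {s : Strands X} (h : s.Proper)
    {p q : X} (hpq : pos p < pos q)
    (hadj : ∀ c, s.next c ≠ c → ¬ (pos p < pos c ∧ pos c < pos q)) {z : ℕ}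
    (hz : ¬ (pos p < z ∧ z ≤ pos q)) (hp0 : s.next p ≠ p) (hq0 : s.next q ≠ q) {x : X} (hxp : x ≠ p)
    (hxq : x ≠ q) (hx0 : s.next x ≠ x)
    (hr : Reaches pos s z x) : Reaches pos (s.glue p q) z x := by
  have h1 := h.next_next
  intro c hcx hcx' hlt
  by_cases hcp : c = p
  · have : (s.glue p q).next c = c := by simp [Strands.glue, hcp]
    rw [this] at hlt; omega
  by_cases hcq : c = q
  · have : (s.glue p q).next c = c := by simp [Strands.glue, hcq]
    rw [this] at hlt; omega
  have hne : ∀ a b : X, a ≠ b → pos a ≠ pos b := fun a b e e' => e (hpos e')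
  have ax := hadj x hx0
  have b3 := hne _ _ hxp
  have b4 := hne _ _ hxq
  have a5 := hadj (s.next p) (by rw [h1]; exact fun e => hp0 e.symm)
  have a6 := hadj (s.next q) (by rw [h1]; exact fun e => hq0 e.symm)
  simp only [Strands.glue, hcp, hcq, hxp, hxq, or_self, if_false] at hcx' hlt ⊢
  by_cases c1 : s.next c = p
  · have e1 : s.next p = c := by rw [← c1, h1]
    simp only [c1, if_true] at hlt ⊢
    have n0 : x ≠ s.next q := by
      rintro rfl
      rw [h1] at hcx'
      split_ifs at hcx' <;> simp_all
    have n1 : s.next x ≠ p := fun e => hcx (by rw [← e1, ← e, h1])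
    have n2 : s.next x ≠ q := fun e => n0 (by rw [← e, h1])
    have m1 : c ≠ s.next x := fun e => hxp (by rw [← c1, e, h1])
    have i1 := hr c hcx m1
    have i2 := hr p (Ne.symm hxp) (Ne.symm n1)
    have i3 := hr q (Ne.symm hxq) (Ne.symm n2)
    have i4 := hr (s.next q) (Ne.symm n0) (fun e => hxq (h.inj e).symm)
    rw [h1] at i4
    rw [c1] at i1
    rw [e1] at i2
    have j1 := hne _ _ n0
    have j2 := hne _ _ hcx
    have j3 := hne _ _ hcp
    have j4 := hne _ _ hq0
    omega
  by_cases c2 : s.next c = q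
  · have e1 : s.next q = c := by rw [← c2, h1]
    rw [if_neg c1, if_pos c2] at hlt ⊢
    have n0 : x ≠ s.next p := by
      rintro rfl
      rw [h1] at hcx'
      split_ifs at hcx' <;> simp_all
    have n1 : s.next x ≠ q := fun e => hcx (by rw [← e1, ← e, h1])
    have n2 : s.next x ≠ p := fun e => n0 (by rw [← e, h1])
    have m1 : c ≠ s.next x := fun e => hxq (by rw [← c2, e, h1])
    have i1 := hr c hcx m1
    have i2 := hr q (Ne.symm hxq) (Ne.symm n1)
    have i3 := hr p (Ne.symm hxp) (Ne.symm n2)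
    have i4 := hr (s.next p) (Ne.symm n0) (fun e => hxp (h.inj e).symm)
    rw [h1] at i4
    rw [c2] at i1
    rw [e1] at i2
    have j1 := hne _ _ n0
    have j2 := hne _ _ hcx
    have j3 := hne _ _ hcq
    have j4 := hne _ _ hp0
    omega
  rw [if_neg c1, if_neg c2] at hlt ⊢
  refine hr c hcx ?_ hlt
  intro e
  exact (by
    rw [e, h1] at c1 c2
    split_ifs at hcx' <;> simp_all)

lemma glue_letter {pos : X → ℕ} (hpos : Function.Injective pos) {s : Strands X} (h : s.Proper)
    (hpl : Planar pos s) {p q : X} (hpq : pos p < pos q)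
    (hadj : ∀ c, s.next c ≠ c → ¬ (pos p < pos c ∧ pos c < pos q)) {Z : Set ℕ}
    (hz : ∀ z ∈ Z, ¬ (pos p < z ∧ z ≤ pos q)) (hp0 : s.next p ≠ p) (hq0 : s.next q ≠ q) {g : Blob}
    (ha : ∀ x, s.next x = x → s.word x = [])
    (hr : ∀ x, g ∈ s.word x → ∃ z ∈ Z, Reaches pos s z x) :
    ∀ x, g ∈ (s.glue p q).word x → ∃ z ∈ Z, Reaches pos (s.glue p q) z x := by
  have h1 := h.next_next
  have hpl' := glue_planar hpos h hpl hpq hadj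
  have hpq' : p ≠ q := fun e => by rw [e] at hpq; omega
  have hP' := h.glue hp0 hq0 hpq'
  have key : ∀ x, x ≠ p → x ≠ q → g ∈ s.word x → ∃ z ∈ Z, Reaches pos (s.glue p q) z x := by
    intro x hxp hxq hx
    obtain ⟨z, hzZ, hzr⟩ := hr x hx
    refine ⟨z, hzZ, glue_reaches hpos h hpq hadj (hz z hzZ) hp0 hq0 hxp hxq ?_ hzr⟩
    intro e
    rw [ha x e] at hx
    simp at hx
  intro x hx
  by_cases hxp : x = p
  · simp [Strands.glue, hxp] at hx
  by_cases hxq : x = q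
  · simp [Strands.glue, hxq] at hx
  by_cases c1 : s.next x = p
  · have hw : g ∈ s.word x ∨ g ∈ s.word q := by simpa [Strands.glue, hxp, hxq, c1] using hx
    rcases hw with hw | hw
    · exact key x hxp hxq hw
    · have n1 : s.next q ≠ p := fun e => hxq (h.inj (c1.trans e.symm))
      obtain ⟨z, hzZ, hzr⟩ := key (s.next q) n1 hq0 (by rw [h.word_next]; simpa using hw)
      refine ⟨z, hzZ, ?_⟩
      have := hzr.next hP' hpl'
      have e1 : s.next p = x := by rw [← c1, h1]
      have e : (s.glue p q).next (s.next q) = x := by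
        simp [Strands.glue, n1, hq0, h1, hpq'.symm, e1]
      rwa [e] at this
  by_cases c2 : s.next x = q
  · have hw : g ∈ s.word x ∨ g ∈ s.word p := by
      simpa [Strands.glue, hxp, hxq, c2, hpq'.symm] using hx
    rcases hw with hw | hw
    · exact key x hxp hxq hw
    · have n1 : s.next p ≠ q := fun e => hxp (h.inj (c2.trans e.symm))
      obtain ⟨z, hzZ, hzr⟩ := key (s.next p) hp0 n1 (by rw [h.word_next]; simpa using hw)
      refine ⟨z, hzZ, ?_⟩
      have := hzr.next hP' hpl'
      have e1 : s.next q = x := by rw [← c2, h1]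
      have e : (s.glue p q).next (s.next p) = x := by
        simp [Strands.glue, n1, hp0, h1, e1]
      rwa [e] at this
  · exact key x hxp hxq (by simpa [Strands.glue, hxp, hxq, c1, c2] using hx)

lemma glue_absent_word {s : Strands X} (h : s.Proper) (ha : ∀ x, s.next x = x → s.word x = [])
    {p q : X} (hp0 : s.next p ≠ p) (hq0 : s.next q ≠ q) (hpq : p ≠ q) :
    ∀ x, (s.glue p q).next x = x → (s.glue p q).word x = [] := by
  intro x hx
  by_cases hxp : x = p
  · simp [Strands.glue, hxp]
  by_cases hxq : x = q
  · simp [Strands.glue, hxq]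
  by_cases hx0 : s.next x = x
  · have := ha x hx0
    simp [Strands.glue, hxp, hxq, hx0, this]
  · exact absurd hx (glue_present h hx0 hxp hxq hpq)

end Strands

/-- Boundary order for two diagrams to be glued. -/
def pos2 {n : ℕ} : Point n ⊕ Point n → ℕ
  | Sum.inl x => pos x
  | Sum.inr x => 2 * n + pos x

lemma pos_lt {n : ℕ} (x : Point n) : pos x < 2 * n := by
  rcases x with i | i <;> simp only [pos] <;> omega

lemma pos_injective {n : ℕ} : Function.Injective (pos (n := n)) := by
  rintro (i | i) (j | j) h <;> simp only [pos] at h <;>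
    first | (congr 1; apply Fin.ext; omega) | omega

lemma pos2_injective {n : ℕ} : Function.Injective (pos2 (n := n)) := by
  rintro (x | x) (y | y) h <;> simp only [pos2] at h
  · rw [pos_injective h]
  · have := pos_lt x; omega
  · have := pos_lt y; omega
  · rw [pos_injective (Nat.add_left_cancel h)]

/-- The invariant kept while two left-right diagrams are glued from left to right. -/
structure Good {n : ℕ} (s : Strands (Point n ⊕ Point n)) : Prop where
  proper : s.Proper
  planar : s.Planar pos2
  absent : ∀ x, s.next x = x → s.word x = []
  left : ∀ x, Blob.L ∈ s.word x → ∃ z ∈ ({0} : Set ℕ), s.Reaches pos2 z x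
  right : ∀ x, Blob.R ∈ s.word x → ∃ z ∈ ({n, 3 * n} : Set ℕ), s.Reaches pos2 z x

lemma good_gluePairs {n : ℕ} (l : List (Fin n)) : ∀ {s : Strands (Point n ⊕ Point n)}, Good s →
    s.Fresh (l.map fun i => (Sum.inl (Sum.inr i), Sum.inr (Sum.inl i))) → l.Pairwise (· < ·) →
    (∀ i ∉ l, s.next (Sum.inl (Sum.inr i)) = Sum.inl (Sum.inr i) ∧
      s.next (Sum.inr (Sum.inl i)) = Sum.inr (Sum.inl i)) →
    Good (s.gluePairs (l.map fun i => (Sum.inl (Sum.inr i), Sum.inr (Sum.inl i)))) := by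
  induction l with
  | nil => intro s h _ _ _; exact h
  | cons i l ih =>
    intro s h hF hs ha
    rw [List.map_cons] at hF
    have hF' := hF.glue h.proper
    have hp0 : s.next (Sum.inl (Sum.inr i)) ≠ Sum.inl (Sum.inr i) :=
      hF.present _ (by rw [ends_cons]; simp)
    have hq0 : s.next (Sum.inr (Sum.inl i)) ≠ Sum.inr (Sum.inl i) :=
      hF.present _ (by rw [ends_cons]; simp)
    have hpq' : (Sum.inl (Sum.inr i) : Point n ⊕ Point n) ≠ Sum.inr (Sum.inl i) := by simp
    have hpq : pos2 (Sum.inl (Sum.inr i) : Point n ⊕ Point n) < pos2 (Sum.inr (Sum.inl i)) := by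
      simp only [pos2, pos]; omega
    have hlt := (List.pairwise_cons.mp hs).1
    have hadj : ∀ c, s.next c ≠ c → ¬ (pos2 (Sum.inl (Sum.inr i) : Point n ⊕ Point n) < pos2 c ∧
        pos2 c < pos2 (Sum.inr (Sum.inl i))) := by
      intro c hc hcc
      have key : ∀ j : Fin n, (j : ℕ) < i → j ∉ i :: l := by
        intro j hj hjl
        rcases List.mem_cons.mp hjl with rfl | hjl
        · omega
        · have := hlt j hjl
          rw [Fin.lt_def] at this
          omega
      rcases c with (j | j) | (j | j) <;> simp only [pos2, pos] at hcc
      · omega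
      · exact hc (ha j (key j (by omega))).1
      · exact hc (ha j (key j (by omega))).2
      · omega
    refine ih (s := s.glue _ _) ⟨hF'.1, glue_planar pos2_injective h.proper h.planar hpq hadj,
      glue_absent_word h.proper h.absent hp0 hq0 hpq',
      glue_letter pos2_injective h.proper h.planar hpq hadj ?_ hp0 hq0 h.absent h.left,
      glue_letter pos2_injective h.proper h.planar hpq hadj ?_ hp0 hq0 h.absent h.right⟩ hF'.2
      (List.pairwise_cons.mp hs).2 ?_
    · intro z hz
      simp only [Set.mem_singleton_iff] at hz
      omega
    · intro z hz
      simp only [Set.mem_insert_iff, Set.mem_singleton_iff] at hz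
      simp only [pos2, pos]
      omega
    · intro j hj
      by_cases hji : j = i
      · subst hji
        exact ⟨by simp [Strands.glue], by simp [Strands.glue]⟩
      · have := ha j (by simp [hji, hj])
        exact ⟨glue_absent this.1, glue_absent this.2⟩

namespace Diagram
variable {n : ℕ}

lemma IsLeftRight.one : IsLeftRight (1 : Diagram n) := by
  refine ⟨?_, ?_, ?_⟩
  · have h : ∀ x : Point n, (1 : Diagram n).next x = Sum.swap x := fun _ => rfl
    rintro (i | i) (j | j) h1 h2 <;> 
      simp only [h, pos, Sum.swap_inl, Sum.swap_inr] at * <;> omega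
  · intro x hx; exact absurd hx (List.not_mem_nil)
  · intro x hx; exact absurd hx (List.not_mem_nil)

lemma reaches_inl {d d' : Diagram n} {z : ℕ} {x : Point n} (hz : z ≤ 2 * n)
    (h : d.Reaches pos z x) :
    (d.toStrands.juxt d'.toStrands).Reaches pos2 z (Sum.inl x) := by
  rintro (c | c) h1 h2 h3
  · exact h c (by simpa using h1) (by simpa [Strands.juxt] using h2)
      (by simpa [Strands.juxt, pos2] using h3)
  · have := pos_lt x
    simp only [Strands.juxt, pos2, Sum.map_inr]
    omega

lemma reaches_inr {d d' : Diagram n} {z : ℕ} {x : Point n}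
    (h : d'.Reaches pos z x) :
    (d.toStrands.juxt d'.toStrands).Reaches pos2 (2 * n + z) (Sum.inr x) := by
  rintro (c | c) h1 h2 h3
  · have := pos_lt (d.next c)
    simp only [Strands.juxt, pos2, Sum.map_inl]
    omega
  · have := h c (by simpa using h1) (by simpa [Strands.juxt] using h2)
      (by simpa [Strands.juxt, pos2] using h3)
    simp only [Strands.juxt, pos2, Sum.map_inr]
    omega

lemma reaches_inr_zero {d d' : Diagram n} {x : Point n} (h : d'.Reaches pos 0 x) :
    (d.toStrands.juxt d'.toStrands).Reaches pos2 0 (Sum.inr x) := by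
  intro c h1 h2 h3
  have := reaches_inr (d := d) h c h1 h2 h3
  rcases c with c | c
  · have := pos_lt (d.next c)
    simp only [Strands.juxt, pos2, Sum.map_inl] at *
    omega
  · simp only [Strands.juxt, pos2, Sum.map_inr] at *
    omega

lemma good_juxt {d d' : Diagram n} (h : d.IsLeftRight) (h' : d'.IsLeftRight) :
    Good (d.toStrands.juxt d'.toStrands) := by
  refine ⟨d.proper.juxt d'.proper, ?_, fun x hx => absurd hx (juxt_ne d d' x), ?_, ?_⟩
  · rintro (c | c) (x | x) h1 h2
    · exact h.planar c x (by simpa using h1) (by simpa [Strands.juxt] using h2)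
    · have := pos_lt (d.next c)
      simp only [Strands.juxt, pos2, Sum.map_inl, Sum.map_inr]
      omega
    · have := pos_lt x
      have := pos_lt (d.next x)
      simp only [Strands.juxt, pos2, Sum.map_inl, Sum.map_inr]
      omega
    · have := h'.planar c x (by simpa using h1) (by simpa [Strands.juxt] using h2)
      simp only [Strands.juxt, pos2, Sum.map_inr]
      omega
  · rintro (x | x) hx
    · exact ⟨0, rfl, reaches_inl (by omega) (h.left x hx)⟩
    · exact ⟨0, rfl, reaches_inr_zero (h'.left x hx)⟩
  · rintro (x | x) hx
    · exact ⟨n, by simp, reaches_inl (by omega) (h.right x hx)⟩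
    · refine ⟨3 * n, by simp, ?_⟩
      have := reaches_inr (d := d) (h'.right x hx)
      rwa [show 2 * n + n = 3 * n by ring] at this

lemma pos2_outer (x : Point n) : pos2 (outer x) = if pos x < n then pos x else 2 * n + pos x := by
  rcases x with i | i <;> split_ifs with h <;>
    simp only [outer, pos2, pos] at * <;> omega

lemma IsLeftRight.mul {d d' : Diagram n} (h : d.IsLeftRight) (h' : d'.IsLeftRight) :
    (d * d').IsLeftRight := by
  have hG : Good ((d.toStrands.juxt d'.toStrands).gluePairs (seam n)) :=
    good_gluePairs _ (good_juxt h h') (fresh d d')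
      (List.pairwise_lt_finRange n) (fun i hi => absurd (List.mem_finRange i) hi)
  have hn := outer_next d d'
  have hR : ∀ z x, z = 0 ∨ z = n ∨ z = 3 * n →
      ((d.toStrands.juxt d'.toStrands).gluePairs (seam n)).Reaches pos2 z (outer x) →
      (d * d').Reaches pos (if z = 0 then 0 else n) x := by
    intro z x hz hr c h1 h2 h3
    have h4 := hr (outer c) (fun e => h1 (outer_injective e))
      (fun e => h2 (by rw [hn] at e; exact outer_injective e))
    rw [mul_toStrands] at *
    simp only [hn, pos2_outer] at h4
    have := pos_lt c
    have := pos_lt x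
    have := pos_lt ((d.toStrands.concat d'.toStrands).next c)
    split_ifs at * <;> omega
  refine ⟨?_, ?_, ?_⟩
  · intro c x h1 h2
    have h3 := hG.planar (outer c) (outer x) (fun e => h1 (outer_injective e))
      (fun e => h2 (by rw [hn] at e; exact outer_injective e))
    rw [mul_toStrands] at *
    simp only [hn, pos2_outer] at h3
    split_ifs at * <;> omega
  · intro x hx
    obtain ⟨z, hz, hr⟩ := hG.left (outer x) hx
    have := hR z x (Or.inl hz) hr
    rwa [if_pos (by simpa using hz)] at this
  · intro x hx
    obtain ⟨z, hz, hr⟩ := hG.right (outer x) hx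
    have hn0 : 0 < n := by
      have := pos_lt x
      omega
    have := hR z x (Or.inr hz) hr
    rwa [if_neg (by rcases hz with hz | hz <;> rw [hz] <;> omega)] at this

end Diagram

/-! ### The Temperley-Lieb algebra -/

namespace Diagram
variable {n : ℕ}

/-- Adjoin the closed loops `m` to a diagram. -/
def addLoops (m : Multiset (ℕ × ℕ)) (d : Diagram n) : Diagram n :=
  { d with loops := d.loops + m }

/-- Remove all blobs from the strands of a diagram, and drop all its closed loops. -/
def bare (d : Diagram n) : Diagram n where
  next := d.next
  word := fun _ => []
  loops := 0
  next_next := d.next_next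
  next_ne := d.next_ne
  word_next := fun _ => rfl

/-- Temperley-Lieb diagrams: no crossings, no blobs, no closed loops. -/
structure IsTL (d : Diagram n) : Prop where
  planar : d.Planar pos
  word : ∀ x, d.word x = []
  loops : d.loops = 0

lemma IsTL.bare_eq {d : Diagram n} (h : d.IsTL) : d.bare = d := by
  apply ext'
  ext1
  · rfl
  · funext x; exact (h.word x).symm
  · exact h.loops.symm

lemma IsTL.isLeftRight {d : Diagram n} (h : d.IsTL) : d.IsLeftRight :=
  ⟨h.planar, fun x hx => by simp [h.word] at hx, fun x hx => by simp [h.word] at hx⟩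

lemma IsLeftRight.isTL_bare {d : Diagram n} (h : d.IsLeftRight) : d.bare.IsTL :=
  ⟨h.planar, fun _ => rfl, rfl⟩

lemma IsLeftRight.addLoops {d : Diagram n} (h : d.IsLeftRight) (m : Multiset (ℕ × ℕ)) :
    (d.addLoops m).IsLeftRight :=
  ⟨h.planar, h.left, h.right⟩

lemma addLoops_mul (m : Multiset (ℕ × ℕ)) (d d' : Diagram n) :
    d.addLoops m * d' = (d * d').addLoops m := by
  have h0 : Sim id m (d.toStrands.juxt d'.toStrands)
      ((d.addLoops m).toStrands.juxt d'.toStrands) :=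
    ⟨fun _ => rfl, fun _ => rfl, by simp [Strands.juxt, addLoops, add_right_comm]⟩
  have h1 := h0.gluePairs Function.injective_id (l := seam n)
  rw [Prod.map_id, List.map_id] at h1
  apply ext'
  ext1
  · funext x
    exact congrArg (Sum.elim id id) (h1.next (outer x))
  · funext x
    exact h1.word (outer x)
  · exact h1.loops

lemma mul_addLoops (m : Multiset (ℕ × ℕ)) (d d' : Diagram n) :
    d * d'.addLoops m = (d * d').addLoops m := by
  have h0 : Sim id m (d.toStrands.juxt d'.toStrands)
      (d.toStrands.juxt (d'.addLoops m).toStrands) :=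
    ⟨fun _ => rfl, fun _ => rfl, by simp [Strands.juxt, addLoops, add_assoc]⟩
  have h1 := h0.gluePairs Function.injective_id (l := seam n)
  rw [Prod.map_id, List.map_id] at h1
  apply ext'
  ext1
  · funext x
    exact congrArg (Sum.elim id id) (h1.next (outer x))
  · funext x
    exact h1.word (outer x)
  · exact h1.loops

lemma gluePairs_word_nil {X : Type} [DecidableEq X] (l : List (X × X)) :
    ∀ {s : Strands X}, (∀ x, s.word x = []) → ∀ x, (s.gluePairs l).word x = [] := by
  induction l with
  | nil => intro s h; exact h
  | cons pq l ih =>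
    intro s h
    exact ih (fun x => by simp [Strands.glue, h])

lemma mul_word_nil {d d' : Diagram n} (h : ∀ x, d.word x = []) (h' : ∀ x, d'.word x = []) (x) :
    (d * d').word x = [] :=
  gluePairs_word_nil (seam n) (by rintro (x | x) <;> simp [Strands.juxt, h, h']) (outer x)

lemma IsTL.mul_eq {d d' : Diagram n} (h : d.IsTL) (h' : d'.IsTL) :
    d * d' = (d * d').bare.addLoops (d * d').loops := by
  apply ext'
  ext1
  · rfl
  · funext x; exact mul_word_nil h.word h'.word x
  · exact (zero_add _).symm

end Diagram

/-- The set of Temperley-Lieb `(n,n)`-diagrams. -/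
abbrev TLDiagram (n : ℕ) : Type := {d : Diagram n // d.IsTL}

namespace TLDiagram
variable {n : ℕ}

/-- The identity diagram. -/
def one : TLDiagram n := ⟨1, ⟨Diagram.IsLeftRight.one.planar, fun _ => rfl, rfl⟩⟩

/-- The diagram left after concatenation and removal of the closed loops. -/
def comp (d d' : TLDiagram n) : TLDiagram n :=
  ⟨(d.1 * d'.1).bare, (d.2.isLeftRight.mul d'.2.isLeftRight).isTL_bare⟩

/-- The number of closed loops that arise in the concatenation. -/
def numLoops (d d' : TLDiagram n) : ℕ := Multiset.card (d.1 * d'.1).loops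

lemma assoc_aux (a b c : TLDiagram n) :
    (comp (comp a b) c = comp a (comp b c)) ∧
      numLoops a b + numLoops (comp a b) c = numLoops b c + numLoops a (comp b c) := by
  have h1 : a.1 * b.1 * c.1 = ((comp a b).1 * c.1).addLoops (a.1 * b.1).loops := by
    rw [← Diagram.addLoops_mul]
    exact congrArg (· * c.1) (a.2.mul_eq b.2)
  have h2 : a.1 * (b.1 * c.1) = (a.1 * (comp b c).1).addLoops (b.1 * c.1).loops := by
    rw [← Diagram.mul_addLoops]
    exact congrArg (a.1 * ·) (b.2.mul_eq c.2)
  rw [mul_assoc, h2] at h1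
  constructor
  · apply Subtype.ext
    exact (congrArg Diagram.bare h1).symm
  · have := congrArg (fun d : Diagram n => Multiset.card d.loops) h1
    simp only [Diagram.addLoops, Multiset.card_add] at this
    simp only [numLoops]
    omega

lemma one_comp (a : TLDiagram n) : comp one a = a ∧ numLoops one a = 0 := by
  have h : (one : TLDiagram n).1 * a.1 = a.1 := one_mul _
  constructor
  · apply Subtype.ext
    change Diagram.bare _ = _
    rw [h, a.2.bare_eq]
  · rw [numLoops, h, a.2.loops]; rfl

lemma comp_one (a : TLDiagram n) : comp a one = a ∧ numLoops a one = 0 := by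
  have h : a.1 * (one : TLDiagram n).1 = a.1 := mul_one _
  constructor
  · apply Subtype.ext
    change Diagram.bare _ = _
    rw [h, a.2.bare_eq]
  · rw [numLoops, h, a.2.loops]; rfl

end TLDiagram

/-- The Temperley-Lieb algebra `TL_n` with loop parameter `δ`: the free `k`-module on the
Temperley-Lieb diagrams. -/
def TemperleyLieb (k : Type*) [CommRing k] (n : ℕ) (_δ : k) : Type _ := TLDiagram n →₀ k

namespace TemperleyLieb
variable {k : Type*} [CommRing k] {n : ℕ} {δ : k}

noncomputable instance : AddCommGroup (TemperleyLieb k n δ) :=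
  inferInstanceAs (AddCommGroup (TLDiagram n →₀ k))

noncomputable instance : Module k (TemperleyLieb k n δ) :=
  inferInstanceAs (Module k (TLDiagram n →₀ k))

/-- The basis element given by a diagram. -/
noncomputable def diagram (d : TLDiagram n) : TemperleyLieb k n δ :=
  (Finsupp.single d 1 : TLDiagram n →₀ k)

/-- The linear map determined by its values on diagrams. -/
noncomputable def lift {M : Type*} [AddCommGroup M] [Module k M] (g : TLDiagram n → M) :
    TemperleyLieb k n δ →ₗ[k] M :=
  (Finsupp.linearCombination k g : (TLDiagram n →₀ k) →ₗ[k] M)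

lemma lift_diagram {M : Type*} [AddCommGroup M] [Module k M] (g : TLDiagram n → M)
    (d : TLDiagram n) : lift (δ := δ) g (diagram d) = g d :=
  (Finsupp.linearCombination_single k 1 d).trans (one_smul k _)

lemma hom_ext {M : Type*} [AddCommGroup M] [Module k M] {g g' : TemperleyLieb k n δ →ₗ[k] M}
    (h : ∀ d, g (diagram d) = g' (diagram d)) : g = g' :=
  Finsupp.lhom_ext' fun d => LinearMap.ext_ring (h d)

variable (k n δ) in
/-- Multiplication: concatenate, and replace each closed loop by `δ`. -/
noncomputable def mulMap :
    TemperleyLieb k n δ →ₗ[k] TemperleyLieb k n δ →ₗ[k] TemperleyLieb k n δ :=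
  lift fun d => lift fun d' => δ ^ TLDiagram.numLoops d d' • diagram (TLDiagram.comp d d')

lemma mulMap_diagram (d d' : TLDiagram n) : mulMap k n δ (diagram d) (diagram d') =
    δ ^ TLDiagram.numLoops d d' • diagram (TLDiagram.comp d d') := by
  rw [mulMap, lift_diagram, lift_diagram]

lemma mulMap_assoc (a b c : TemperleyLieb k n δ) :
    mulMap k n δ (mulMap k n δ a b) c = mulMap k n δ a (mulMap k n δ b c) := by
  have h1 : (mulMap k n δ).flip c ∘ₗ (mulMap k n δ).flip b =
      (mulMap k n δ).flip (mulMap k n δ b c) := by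
    apply hom_ext
    intro da
    have h2 : (mulMap k n δ).flip c ∘ₗ mulMap k n δ (diagram da) =
        mulMap k n δ (diagram da) ∘ₗ (mulMap k n δ).flip c := by
      apply hom_ext
      intro db
      have h3 : mulMap k n δ (mulMap k n δ (diagram da) (diagram db)) =
          mulMap k n δ (diagram da) ∘ₗ mulMap k n δ (diagram db) := by
        apply hom_ext
        intro dc
        have h4 := TLDiagram.assoc_aux da db dc
        rw [LinearMap.comp_apply, mulMap_diagram, mulMap_diagram, map_smul, map_smul,
          LinearMap.smul_apply, mulMap_diagram, mulMap_diagram, smul_smul, smul_smul, ← pow_add,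
          ← pow_add, h4.1, h4.2]
      exact LinearMap.congr_fun h3 c
    exact LinearMap.congr_fun h2 b
  exact LinearMap.congr_fun h1 a

noncomputable instance : Ring (TemperleyLieb k n δ) :=
  { (inferInstance : AddCommGroup (TemperleyLieb k n δ)) with
    mul := fun a b => mulMap k n δ a b
    one := diagram TLDiagram.one
    mul_assoc := mulMap_assoc
    one_mul := fun a => by
      change mulMap k n δ (diagram TLDiagram.one) a = a
      have h : mulMap k n δ (diagram TLDiagram.one) = LinearMap.id := by
        apply hom_ext
        intro d
        rw [mulMap_diagram, (TLDiagram.one_comp d).1, (TLDiagram.one_comp d).2, pow_zero,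
          one_smul, LinearMap.id_apply]
      rw [h, LinearMap.id_apply]
    mul_one := fun a => by
      change (mulMap k n δ).flip (diagram TLDiagram.one) a = a
      have h : (mulMap k n δ).flip (diagram TLDiagram.one) = LinearMap.id := by
        apply hom_ext
        intro d
        rw [LinearMap.flip_apply, mulMap_diagram, (TLDiagram.comp_one d).1,
          (TLDiagram.comp_one d).2, pow_zero, one_smul, LinearMap.id_apply]
      rw [h, LinearMap.id_apply]
    zero_mul := fun a => by
      change mulMap k n δ 0 a = 0
      simp
    mul_zero := fun a => map_zero (mulMap k n δ a)
    left_distrib := fun a b c => map_add (mulMap k n δ a) b c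
    right_distrib := fun a b c => by
      change mulMap k n δ (a + b) c = mulMap k n δ a c + mulMap k n δ b c
      simp }

noncomputable instance : Algebra k (TemperleyLieb k n δ) :=
  Algebra.ofModule
    (fun r a b => by
      change mulMap k n δ (r • a) b = r • mulMap k n δ a b
      simp)
    (fun r a b => map_smul (mulMap k n δ a) r b)

end TemperleyLieb

/-! ### The symplectic blob algebra -/

/-- The monoid of left-right blob pseudo-diagrams (for `n` odd) under concatenation. A closed loop is
recorded only by its numbers of blobs: this, and not its place, is all that its value depends on. -/
def LRDiagram (n : ℕ) : Submonoid (Diagram n) where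
  carrier := {d | d.IsLeftRight}
  one_mem' := Diagram.IsLeftRight.one
  mul_mem' := fun h h' => h.mul h'

namespace LRDiagram
variable {n : ℕ}

/-- Adjoin the closed loops `m`. -/
def addLoops (m : Multiset (ℕ × ℕ)) (d : LRDiagram n) : LRDiagram n :=
  ⟨d.1.addLoops m, Diagram.IsLeftRight.addLoops d.2 m⟩

/-- The Temperley-Lieb diagram obtained by removing all blobs (and dropping closed loops). -/
def removeBlobs (d : LRDiagram n) : TLDiagram n :=
  ⟨d.1.bare, Diagram.IsLeftRight.isTL_bare d.2⟩

/-- The horizontal position of an endpoint. -/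
def column (x : Point n) : Fin n := Sum.elim id id x

lemma column_swap (x : Point n) : column ((1 : Diagram n).next x) = column x := by
  rcases x with x | x <;> rfl

/-- The diagram `e`: the identity diagram with one left blob on its first strand. -/
def e (n : ℕ) : LRDiagram n :=
  ⟨{ (1 : Diagram n) with
      word := fun x => if (column x : ℕ) = 0 then [Blob.L] else []
      word_next := fun x => by
        change (if (column ((1 : Diagram n).next x) : ℕ) = 0 then _ else _) = _
        rw [column_swap]
        split_ifs <;> rfl },
    by
      refine ⟨Diagram.IsLeftRight.one.planar, fun x hx => ?_, fun x hx => ?_⟩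
      · have hx0 : (column x : ℕ) = 0 := by
          by_contra h
          simp [h] at hx
        intro c _ _ _
        change (pos c < 0 ∧ 0 ≤ pos ((1 : Diagram n).next c)) ↔
          (pos c < pos x ∧ pos x < pos ((1 : Diagram n).next c))
        have hx1 : pos x = 0 ∨ pos x = 2 * n - 1 := by
          rcases x with x | x <;> simp only [column, Sum.elim_inl, Sum.elim_inr, id] at hx0 <;>
            simp only [pos] <;> omega
        have h2 : pos ((1 : Diagram n).next c) < 2 * n := pos_lt _
        omega
      · by_cases h : (column x : ℕ) = 0 <;> simp [h] at hx⟩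

/-- The diagram `f`: the identity diagram with one right blob on its last strand. -/
def f (n : ℕ) : LRDiagram n :=
  ⟨{ (1 : Diagram n) with
      word := fun x => if (column x : ℕ) + 1 = n then [Blob.R] else []
      word_next := fun x => by
        change (if (column ((1 : Diagram n).next x) : ℕ) + 1 = n then _ else _) = _
        rw [column_swap]
        split_ifs <;> rfl },
    by
      refine ⟨Diagram.IsLeftRight.one.planar, fun x hx => ?_, fun x hx => ?_⟩
      · by_cases h : (column x : ℕ) + 1 = n <;> simp [h] at hx
      · have hx0 : (column x : ℕ) + 1 = n := by
          by_contra h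
          simp [h] at hx
        intro c hc hc' hlt
        change c ≠ (1 : Diagram n).next x at hc'
        change pos c < pos ((1 : Diagram n).next c) at hlt
        change (pos c < n ∧ n ≤ pos ((1 : Diagram n).next c)) ↔
          (pos c < pos x ∧ pos x < pos ((1 : Diagram n).next c))
        have h1 : ∀ i, (1 : Diagram n).next (Sum.inl i) = Sum.inr i := fun _ => rfl
        have h2 : ∀ i, (1 : Diagram n).next (Sum.inr i) = Sum.inl i := fun _ => rfl
        rcases x with x | x <;> rcases c with c | c <;>
          simp only [column, Sum.elim_inl, Sum.elim_inr, id, h1, h2, pos, ne_eq, Sum.inl.injEq,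
            Sum.inr.injEq, Fin.ext_iff] at * <;> omega⟩

end LRDiagram

section
variable {k : Type*} [CommRing k]

/-- Straightening rules for the blobs on a line: `WordRule w c v` says that a line segment with
blobs `w` is replaced by `c` times the segment with blobs `v`. -/
inductive WordRule (δL δR κLR : k) : List Blob → k → List Blob → Prop
  | LL : WordRule δL δR κLR [Blob.L, Blob.L] δL [Blob.L]
  | RR : WordRule δL δR κLR [Blob.R, Blob.R] δR [Blob.R]
  | LRL : WordRule δL δR κLR [Blob.L, Blob.R, Blob.L] κLR [Blob.L]
  | RLR : WordRule δL δR κLR [Blob.R, Blob.L, Blob.R] κLR [Blob.R]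

/-- Straightening rules for closed loops: `LoopRule (i, j) c` says that a loop with `i` left and `j`
right blobs is replaced by the scalar `c`. -/
inductive LoopRule (δ κL κR κLR : k) : ℕ × ℕ → k → Prop
  | plain : LoopRule δ κL κR κLR (0, 0) δ
  | L : LoopRule δ κL κR κLR (1, 0) κL
  | R : LoopRule δ κL κR κLR (0, 1) κR
  | LR : LoopRule δ κL κR κLR (1, 1) κLR

/-- The straightening relations on linear combinations of left-right blob pseudo-diagrams:
* `strand`: apply a `WordRule` to a part of the word on the strand at `x`;
* `loop`: replace a closed loop by a scalar;
* `loopLL`, `loopRR`: replace two consecutive equal blobs on a closed loop by one. -/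
inductive Straighten {n : ℕ} (δ δL δR κL κR κLR : k) :
    MonoidAlgebra k (LRDiagram n) → MonoidAlgebra k (LRDiagram n) → Prop
  | strand (d d' : LRDiagram n) (x : Point n) (u v w w' : List Blob) (c : k)
      (hrule : WordRule δL δR κLR w c w')
      (hd : d.1.word x = u ++ w ++ v) (hd' : d'.1.word x = u ++ w' ++ v)
      (hword : ∀ y, y ≠ x → y ≠ d.1.next x → d'.1.word y = d.1.word y)
      (hnext : d'.1.next = d.1.next) (hloops : d'.1.loops = d.1.loops) :
      Straighten δ δL δR κL κR κLR (MonoidAlgebra.of k _ d) (c • MonoidAlgebra.of k _ d')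
  | loop (d : LRDiagram n) (t : ℕ × ℕ) (c : k) (hrule : LoopRule δ κL κR κLR t c) :
      Straighten δ δL δR κL κR κLR (MonoidAlgebra.of k _ (LRDiagram.addLoops {t} d))
        (c • MonoidAlgebra.of k _ d)
  | loopLL (d : LRDiagram n) (i j : ℕ) :
      Straighten δ δL δR κL κR κLR
        (MonoidAlgebra.of k _ (LRDiagram.addLoops {(i + 2, j)} d))
        (δL • MonoidAlgebra.of k _ (LRDiagram.addLoops {(i + 1, j)} d))
  | loopRR (d : LRDiagram n) (i j : ℕ) :
      Straighten δ δL δR κL κR κLR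
        (MonoidAlgebra.of k _ (LRDiagram.addLoops {(i, j + 2)} d))
        (δR • MonoidAlgebra.of k _ (LRDiagram.addLoops {(i, j + 1)} d))

/-- The symplectic blob algebra, for `n` odd: linear combinations of left-right blob
pseudo-diagrams, with multiplication by concatenation, modulo the straightening relations. (The
topological relation, which identifies certain diagrams without a strand from top to bottom, is void
for `n` odd, as then every diagram has such a strand.) -/
abbrev SymplecticBlob (n : ℕ) (δ δL δR κL κR κLR : k) : Type _ :=
  RingQuot (Straighten (n := n) δ δL δR κL κR κLR)

/-- The element of the symplectic blob algebra given by a diagram. -/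
noncomputable def SymplecticBlob.diagram {n : ℕ} (δ δL δR κL κR κLR : k) (d : LRDiagram n) :
    SymplecticBlob n δ δL δR κL κR κLR :=
  RingQuot.mkAlgHom k _ (MonoidAlgebra.of k _ d)

/-- The two-sided ideal generated by `e - 1` and `f - 1`. -/
noncomputable def SymplecticBlob.ideal (n : ℕ) (δ δL δR κL κR κLR : k) :
    TwoSidedIdeal (SymplecticBlob n δ δL δR κL κR κLR) :=
  TwoSidedIdeal.span {SymplecticBlob.diagram δ δL δR κL κR κLR (LRDiagram.e n) - 1,
    SymplecticBlob.diagram δ δL δR κL κR κLR (LRDiagram.f n) - 1}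

end

end SympBlob

/-!
Removing blobs respects the straightening relations when `δ = κL = κR` and `δL = δR = κLR = 1`, except
that a loop carrying both kinds of blobs has the value `1` instead of `δ`. So removing blobs is
multiplicative as soon as no such loop arises when two left-right diagrams are concatenated. This
holds for `n` odd (`Good.not_both`): by parity there are strands that separate the left edge from the
right edge. This gives an algebra map from the symplectic blob algebra onto the Temperley-Lieb
algebra that sends `e` and `f` to `1`, hence a map from the quotient (`quotientToTL`).

For injectivity it has to be shown that blobs can be removed in the quotient (`mkDiagram_eq`). This is
done one blob at a time, by writing a diagram as `A * e * B` (or `A * f * B`) such that `A * B` is the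
same diagram with one blob less (`exists_mul_e_mul`). No power of `δ`, which may be zero, must be
lost here, so `A * B` has to produce no loops. Let the strand that starts with a blob `L` have its
first end at the `i`-th top endpoint. As it is exposed to the left edge, the endpoints before it are
joined among themselves, and `i` is even. Then `A` has these `i` endpoints joined as in the given
diagram and moves the exposed strand to the left edge, where `e` can act on it; below, it has `i`
endpoints joined in adjacent pairs, and `B` has its first `i` top endpoints joined in adjacent pairs,
so that in `A * B` all these arcs become part of the exposed strand. The other positions of the
blob, and the right blobs, follow by reflections of the diagrams (`vflip`, `hflip`).

Concatenations are computed by following strands across the seam (`Strands.Walk`).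
-/

namespace SympBlob

open Strands

/-! ### Walks along strands and glued pairs -/

namespace Strands
variable {X : Type}

/-- `s.Walk l x y w`: starting at `x`, one arrives at `y` by following strands of `s` alternately
with jumps between the two endpoints of a pair in `l`; the blobs met on the way form `w`. -/
inductive Walk (s : Strands X) (l : List (X × X)) (x : X) : X → List Blob → Prop
  | start : Walk s l x (s.next x) (s.word x)
  | step {p q : X} {w : List Blob} : Walk s l x p w → (p, q) ∈ l ∨ (q, p) ∈ l →
      Walk s l x (s.next q) (w ++ s.word q)

lemma mem_ends {l : List (X × X)} {p q : X} (h : (p, q) ∈ l ∨ (q, p) ∈ l) :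
    p ∈ ends l ∧ q ∈ ends l := by
  simp only [ends, List.mem_flatMap]
  rcases h with h | h
  · exact ⟨⟨_, h, by simp⟩, ⟨_, h, by simp⟩⟩
  · exact ⟨⟨_, h, by simp⟩, ⟨_, h, by simp⟩⟩

variable [DecidableEq X]

/-- Gluing one pair turns walks into walks. A walk that arrives at `p` has to go on from `q`; here
`s.next p ≠ q`, because a walk from outside never enters a closed loop. -/
lemma Walk.glue {s : Strands X} (h : s.Proper) {p q : X} {l : List (X × X)}
    (hF : s.Fresh ((p, q) :: l)) {x y : X} {w : List Blob} (hx : x ∉ ends ((p, q) :: l))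
    (hw : s.Walk ((p, q) :: l) x y w) :
    (y ≠ p → y ≠ q → (s.glue p q).Walk l x y w) ∧
      (y = p → s.next p ≠ q ∧ (s.glue p q).Walk l x (s.next q) (w ++ s.word q)) ∧
      (y = q → s.next q ≠ p ∧ (s.glue p q).Walk l x (s.next p) (w ++ s.word p)) := by
  have h1 := h.next_next
  obtain ⟨hn, hp⟩ := hF
  rw [ends_cons] at hn hp hx
  simp only [List.nodup_cons, List.mem_cons, not_or] at hn hp hx
  have hp0 := hp p (Or.inl rfl)
  have hq0 := hp q (Or.inr (Or.inl rfl))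
  -- what a strand of `s` that starts outside the pair becomes in the glued system
  have key : ∀ z, z ≠ p → z ≠ q →
      (s.next z ≠ p → s.next z ≠ q →
        (s.glue p q).next z = s.next z ∧ (s.glue p q).word z = s.word z) ∧
      (s.next z = p → s.next p ≠ q ∧
        (s.glue p q).next z = s.next q ∧ (s.glue p q).word z = s.word z ++ s.word q) ∧
      (s.next z = q → s.next q ≠ p ∧
        (s.glue p q).next z = s.next p ∧ (s.glue p q).word z = s.word z ++ s.word p) := by
    intro z hzp hzq
    simp only [Strands.glue]
    grind
  induction hw with
  | start =>
    obtain ⟨k1, k2, k3⟩ := key x hx.1 hx.2.1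
    refine ⟨fun a b => ?_, fun a => ⟨(k2 a).1, ?_⟩, fun a => ⟨(k3 a).1, ?_⟩⟩
    · have := k1 a b
      rw [← this.1, ← this.2]
      exact .start
    · have := k2 a
      rw [← this.2.1, ← this.2.2]
      exact .start
    · have := k3 a
      rw [← this.2.1, ← this.2.2]
      exact .start
  | @step p' q' w' _ hpq ih =>
    by_cases hl : (p', q') ∈ l ∨ (q', p') ∈ l
    · have hm := mem_ends hl
      have e1 : p' ≠ p := fun e => hn.1.2 (e ▸ hm.1)
      have e2 : p' ≠ q := fun e => hn.2.1 (e ▸ hm.1)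
      have e3 : q' ≠ p := fun e => hn.1.2 (e ▸ hm.2)
      have e4 : q' ≠ q := fun e => hn.2.1 (e ▸ hm.2)
      have hW := (ih.1 e1 e2).step hl
      obtain ⟨k1, k2, k3⟩ := key q' e3 e4
      refine ⟨fun a b => ?_, fun a => ⟨(k2 a).1, ?_⟩, fun a => ⟨(k3 a).1, ?_⟩⟩
      · have := k1 a b
        rwa [this.1, this.2] at hW
      · have := k2 a
        rwa [this.2.1, this.2.2, ← List.append_assoc] at hW
      · have := k3 a
        rwa [this.2.1, this.2.2, ← List.append_assoc] at hW
    · have hc : p' = p ∧ q' = q ∨ p' = q ∧ q' = p := by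
        simp only [List.mem_cons, Prod.mk.injEq] at hpq
        tauto
      rcases hc with ⟨rfl, rfl⟩ | ⟨rfl, rfl⟩
      · have := ih.2.1 rfl
        refine ⟨fun _ _ => this.2, fun e => ?_, fun e => absurd e hq0⟩
        exact absurd (by rw [← e, h1]) this.1
      · have := ih.2.2 rfl
        refine ⟨fun _ _ => this.2, fun e => absurd e hp0, fun e => ?_⟩
        exact absurd (by rw [← e, h1]) this.1

/-- A walk between remaining endpoints is a strand of the glued system. -/
lemma Walk.gluePairs {l : List (X × X)} {x y : X} {w : List Blob} (hx : x ∉ ends l)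
    (hy : y ∉ ends l) : ∀ {s : Strands X}, s.Proper → s.Fresh l → s.Walk l x y w →
    (s.gluePairs l).next x = y ∧ (s.gluePairs l).word x = w := by
  induction l with
  | nil =>
    intro s _ _ hw
    cases hw with
    | start => exact ⟨rfl, rfl⟩
    | step _ hpq => simp at hpq
  | cons pq l ih =>
    intro s h hF hw
    have := (hw.glue h hF hx).1
    rw [ends_cons] at hx hy
    simp only [List.mem_cons, not_or] at hx hy
    exact ih hx.2.2 hy.2.2 (hF.glue h).1 (hF.glue h).2 (this hy.1 hy.2.1)

/-- If all the glued endpoints lie on strands with an end outside, then no closed loop arises. -/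
lemma gluePairs_loops_of_walk {l : List (X × X)} : ∀ {s : Strands X}, s.Proper → s.Fresh l →
    (∀ pq ∈ l, ∃ x ∉ ends l, ∃ w, s.Walk l x pq.1 w ∨ s.Walk l x pq.2 w) →
    (s.gluePairs l).loops = s.loops := by
  induction l with
  | nil => intro s _ _ _; rfl
  | cons pq l ih =>
    intro s h hF hw
    have hn := hF.nodup
    rw [ends_cons] at hn
    simp only [List.nodup_cons, List.mem_cons, not_or] at hn
    rw [gluePairs_cons, ih (hF.glue h).1 (hF.glue h).2]
    · obtain ⟨x, hx, w, hw | hw⟩ := hw pq (by simp)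
      · have := ((hw.glue h hF hx).2.1 rfl).1
        simp [Strands.glue, this]
      · have := ((hw.glue h hF hx).2.2 rfl).1
        have : s.next pq.1 ≠ pq.2 := fun e => this (by rw [← e, h.next_next])
        simp [Strands.glue, this]
    · intro rt hrt
      have hm := mem_ends (p := rt.1) (q := rt.2) (Or.inl hrt)
      obtain ⟨x, hx, w, hw⟩ := hw rt (by simp [hrt])
      refine ⟨x, fun hx' => hx (by rw [ends_cons]; simp [hx']), w, ?_⟩
      refine hw.imp (fun hw => ?_) (fun hw => ?_) <;> refine (hw.glue h hF hx).1 ?_ ?_ <;>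
        rintro e <;> rw [e] at hm <;> tauto

/-- The pairing obtained by gluing does not depend on the blobs. -/
lemma gluePairs_next_congr (l : List (X × X)) : ∀ {s t : Strands X}, s.next = t.next →
    (s.gluePairs l).next = (t.gluePairs l).next := by
  induction l with
  | nil => intro s t h; exact h
  | cons pq l ih =>
    intro s t h
    refine ih ?_
    funext x
    simp [Strands.glue, h]

end Strands

/-! ### Parity -/

/-- A set of endpoints of odd size is not closed under passing to the other end of the strand. -/
lemma exists_next_not_mem {X : Type} {s : Strands X} (h : s.Proper) {m : ℕ} (hm : Odd m)
    {ι : Fin m → X} (hι : Function.Injective ι) (hne : ∀ j, s.next (ι j) ≠ ι j) :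
    ∃ j, ∀ j', s.next (ι j) ≠ ι j' := by
  by_contra! hc
  choose g hg using hc
  have h0 : ∑ _j : Fin m, (1 : ZMod 2) = 0 := by
    refine Finset.sum_involution (fun j _ => g j) (fun _ _ => by decide) (fun j _ _ e => ?_)
      (fun _ _ => Finset.mem_univ _) (fun j _ => hι ?_)
    · exact hne j (by rw [hg, e])
    · rw [← hg, ← hg, h.next_next]
  rw [Finset.sum_const, Finset.card_univ, Fintype.card_fin, nsmul_one,
    ZMod.natCast_eq_zero_iff_even] at h0
  exact Nat.not_even_iff_odd.mpr hm h0

namespace Diagram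
variable {n : ℕ}

lemma mul_of_walk {d d' : Diagram n} {x y : Point n} {w : List Blob}
    (h : (d.toStrands.juxt d'.toStrands).Walk (seam n) (outer x) (outer y) w) :
    (d * d').next x = y ∧ (d * d').word x = w := by
  have := h.gluePairs (outer_not_mem x) (outer_not_mem y) (d.proper.juxt d'.proper) (fresh d d')
  refine ⟨outer_injective ?_, this.2⟩
  rw [mul_toStrands, ← outer_next, this.1]

lemma mem_seam (i : Fin n) :
    ((Sum.inl (Sum.inr i), Sum.inr (Sum.inl i)) : (Point n ⊕ Point n) × (Point n ⊕ Point n)) ∈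
      seam n := by
  simp [seam]

lemma mul_loops_of_walk {d d' : Diagram n}
    (h : ∀ i, ∃ x w, (d.toStrands.juxt d'.toStrands).Walk (seam n) (outer x)
        (Sum.inl (Sum.inr i)) w ∨
      (d.toStrands.juxt d'.toStrands).Walk (seam n) (outer x) (Sum.inr (Sum.inl i)) w) :
    (d * d').loops = d.loops + d'.loops := by
  refine gluePairs_loops_of_walk (d.proper.juxt d'.proper) (fresh d d') fun pq hpq => ?_
  obtain ⟨i, -, rfl⟩ := List.mem_map.mp hpq
  obtain ⟨x, w, hw⟩ := h i
  exact ⟨outer x, outer_not_mem x, w, hw⟩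

/-- Each diagram with an odd number of top endpoints has a strand from top to bottom. -/
lemma exists_through (d : Diagram n) (hn : Odd n) : ∃ x, pos x < n ∧ n ≤ pos (d.next x) := by
  obtain ⟨j, hj⟩ := exists_next_not_mem d.proper hn Sum.inl_injective fun j => d.next_ne _
  refine ⟨Sum.inl j, j.2, ?_⟩
  rcases hx : d.next (Sum.inl j) with j' | j'
  · exact absurd hx (hj j')
  · simp only [pos]
    omega

end Diagram

/-! ### Closed loops in a concatenation -/

/-- One step of the gluing from left to right keeps the invariant; `l` lists the later steps. -/
lemma Good.glue {n : ℕ} {i : Fin n} {l : List (Fin n)} {s : Strands (Point n ⊕ Point n)}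
    (h : Good s)
    (hF : s.Fresh ((i :: l).map fun i => (Sum.inl (Sum.inr i), Sum.inr (Sum.inl i))))
    (hs : (i :: l).Pairwise (· < ·))
    (ha : ∀ j ∉ i :: l, s.next (Sum.inl (Sum.inr j)) = Sum.inl (Sum.inr j) ∧
      s.next (Sum.inr (Sum.inl j)) = Sum.inr (Sum.inl j)) :
    Good (s.glue (Sum.inl (Sum.inr i)) (Sum.inr (Sum.inl i))) := by
  rw [List.map_cons] at hF
  have hp0 : s.next (Sum.inl (Sum.inr i)) ≠ Sum.inl (Sum.inr i) :=
    hF.present _ (by rw [ends_cons]; simp)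
  have hq0 : s.next (Sum.inr (Sum.inl i)) ≠ Sum.inr (Sum.inl i) :=
    hF.present _ (by rw [ends_cons]; simp)
  have hpq' : (Sum.inl (Sum.inr i) : Point n ⊕ Point n) ≠ Sum.inr (Sum.inl i) := by simp
  have hpq : pos2 (Sum.inl (Sum.inr i) : Point n ⊕ Point n) < pos2 (Sum.inr (Sum.inl i)) := by
    simp only [pos2, pos]; omega
  have key : ∀ j : Fin n, (j : ℕ) < i → j ∉ i :: l := by
    intro j hj hjl
    rcases List.mem_cons.mp hjl with rfl | hjl
    · omega
    · have := (List.pairwise_cons.mp hs).1 j hjl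
      rw [Fin.lt_def] at this
      omega
  have hadj : ∀ c, s.next c ≠ c → ¬ (pos2 (Sum.inl (Sum.inr i) : Point n ⊕ Point n) < pos2 c ∧
      pos2 c < pos2 (Sum.inr (Sum.inl i))) := by
    intro c hc hcc
    rcases c with (j | j) | (j | j) <;> simp only [pos2, pos] at hcc
    · omega
    · exact hc (ha j (key j (by omega))).1
    · exact hc (ha j (key j (by omega))).2
    · omega
  refine ⟨(hF.glue h.proper).1, glue_planar pos2_injective h.proper h.planar hpq hadj,
    glue_absent_word h.proper h.absent hp0 hq0 hpq',
    glue_letter pos2_injective h.proper h.planar hpq hadj ?_ hp0 hq0 h.absent h.left,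
    glue_letter pos2_injective h.proper h.planar hpq hadj ?_ hp0 hq0 h.absent h.right⟩
  · intro z hz
    simp only [Set.mem_singleton_iff] at hz
    omega
  · intro z hz
    simp only [Set.mem_insert_iff, Set.mem_singleton_iff] at hz
    simp only [pos2, pos]
    omega

/-- For `n` odd, a strand that is about to be closed to a loop does not carry both kinds of blobs:
by parity there is a strand from the `n` top endpoints of the first diagram, and one from the `n`
bottom endpoints of the second, to other endpoints, and these strands separate the left edge from
the right edge. -/
lemma Good.not_both {n : ℕ} (hn : Odd n) {s : Strands (Point n ⊕ Point n)} (h : Good s)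
    (hout : ∀ x, s.next (outer x) ≠ outer x) {i : Fin n}
    (hi : s.next (Sum.inl (Sum.inr i)) = Sum.inr (Sum.inl i)) :
    Blob.L ∉ s.word (Sum.inl (Sum.inr i)) ∨ Blob.R ∉ s.word (Sum.inl (Sum.inr i)) := by
  by_contra! hc
  obtain ⟨z, rfl, h0⟩ := h.left _ hc.1
  obtain ⟨z, hz, hr⟩ := h.right _ hc.2
  have main : ∀ c, c ≠ Sum.inl (Sum.inr i) → c ≠ Sum.inr (Sum.inl i) →
      ¬ (pos2 c < z ∧ z ≤ pos2 (s.next c)) := by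
    intro c h1 h2 h3
    have e0 := h0 c h1 (by rwa [hi]) (by omega)
    have e1 := hr c h1 (by rwa [hi]) (by omega)
    omega
  simp only [Set.mem_insert_iff, Set.mem_singleton_iff] at hz
  rcases hz with hz | hz <;> rw [hz] at main
  · obtain ⟨j, hj⟩ := exists_next_not_mem h.proper hn
      (ι := fun j => (Sum.inl (Sum.inl j) : Point n ⊕ Point n)) (fun _ _ e => by simpa using e)
      fun j => hout (Sum.inl j)
    refine main (Sum.inl (Sum.inl j)) (by simp) (by simp) ⟨by simp [pos2, pos], ?_⟩
    rcases hx : s.next (Sum.inl (Sum.inl j)) with (a | a) | a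
    · exact absurd hx (hj a)
    · simp only [pos2, pos]; omega
    · simp only [pos2]; omega
  · obtain ⟨j, hj⟩ := exists_next_not_mem h.proper hn
      (ι := fun j => (Sum.inr (Sum.inr j) : Point n ⊕ Point n)) (fun _ _ e => by simpa using e)
      fun j => hout (Sum.inr j)
    refine main (s.next (Sum.inr (Sum.inr j))) ?_ ?_ ⟨?_, ?_⟩
    · intro e
      have := congrArg s.next e
      rw [h.proper.next_next, hi] at this
      simp at this
    · intro e
      have := congrArg s.next e
      rw [h.proper.next_next, ← hi, h.proper.next_next] at this
      simp at this
    · rcases hx : s.next (Sum.inr (Sum.inr j)) with a | a | a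
      · have := pos_lt a
        simp only [pos2]
        omega
      · simp only [pos2, pos]; omega
      · exact absurd hx (hj a)
    · rw [h.proper.next_next]
      simp only [pos2, pos]
      omega

/-- Gluing creates equally many loops whether or not the strands carry blobs, and for `n` odd no new
loop carries both kinds of blobs. -/
lemma new_loops {n : ℕ} (hn : Odd n) (l : List (Fin n)) : ∀ {s t : Strands (Point n ⊕ Point n)},
    Good s → s.next = t.next →
    s.Fresh (l.map fun i => (Sum.inl (Sum.inr i), Sum.inr (Sum.inl i))) → l.Pairwise (· < ·) →
    (∀ i ∉ l, s.next (Sum.inl (Sum.inr i)) = Sum.inl (Sum.inr i) ∧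
      s.next (Sum.inr (Sum.inl i)) = Sum.inr (Sum.inl i)) →
    (∀ x, s.next (outer x) ≠ outer x) →
    ∃ c c' : Multiset (ℕ × ℕ),
      (s.gluePairs (l.map fun i => (Sum.inl (Sum.inr i), Sum.inr (Sum.inl i)))).loops =
        s.loops + c ∧
      (t.gluePairs (l.map fun i => (Sum.inl (Sum.inr i), Sum.inr (Sum.inl i)))).loops =
        t.loops + c' ∧
      Multiset.card c = Multiset.card c' ∧ ∀ u ∈ c, u.1 = 0 ∨ u.2 = 0 := by
  induction l with
  | nil => intro s t _ _ _ _ _ _; exact ⟨0, 0, by simp [Strands.gluePairs]⟩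
  | cons i l ih =>
    intro s t h hst hF hs ha hout
    have hG := h.glue hF hs ha
    have hst' : (s.glue (Sum.inl (Sum.inr i)) (Sum.inr (Sum.inl i))).next =
        (t.glue (Sum.inl (Sum.inr i)) (Sum.inr (Sum.inl i))).next := by
      funext x; simp [Strands.glue, hst]
    rw [List.map_cons] at hF
    obtain ⟨c, c', h1, h2, h3, h4⟩ := ih hG hst' (hF.glue h.proper).2
      (List.pairwise_cons.mp hs).2 (by
        intro j hj
        by_cases hji : j = i
        · subst hji
          exact ⟨by simp [Strands.glue], by simp [Strands.glue]⟩
        · have := ha j (by simp [hji, hj])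
          exact ⟨glue_absent this.1, glue_absent this.2⟩)
      (fun x => glue_present h.proper (hout x) (by rcases x with x | x <;> simp [outer])
        (by rcases x with x | x <;> simp [outer]) (by simp))
    rw [List.map_cons, gluePairs_cons, gluePairs_cons, h1, h2]
    by_cases e : s.next (Sum.inl (Sum.inr i)) = Sum.inr (Sum.inl i)
    · have e' : t.next (Sum.inl (Sum.inr i)) = Sum.inr (Sum.inl i) := by rw [← hst, e]
      refine ⟨loopType (s.word (Sum.inl (Sum.inr i))) ::ₘ c,
        loopType (t.word (Sum.inl (Sum.inr i))) ::ₘ c', ?_, ?_, by simp [h3], ?_⟩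
      · simp [Strands.glue, e]
      · simp [Strands.glue, e']
      · intro u hu
        rcases Multiset.mem_cons.mp hu with rfl | hu
        · refine (h.not_both hn hout e).imp ?_ ?_ <;> exact List.count_eq_zero.mpr
        · exact h4 u hu
    · have e' : t.next (Sum.inl (Sum.inr i)) ≠ Sum.inr (Sum.inl i) := by rwa [← hst]
      exact ⟨c, c', by simp [Strands.glue, e], by simp [Strands.glue, e'], h3, h4⟩

namespace LRDiagram
variable {n : ℕ}

lemma removeBlobs_mul (d d' : LRDiagram n) :
    removeBlobs (d * d') = TLDiagram.comp (removeBlobs d) (removeBlobs d') := by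
  apply Subtype.ext
  apply Diagram.ext'
  ext1
  · funext x
    refine congrArg (Sum.elim id id) (congrFun (gluePairs_next_congr (seam n) ?_) (outer x))
    rfl
  · rfl
  · rfl

lemma mul_loops (hn : Odd n) (d d' : LRDiagram n) : ∃ c : Multiset (ℕ × ℕ),
    (d * d').1.loops = d.1.loops + d'.1.loops + c ∧
      Multiset.card c = TLDiagram.numLoops (removeBlobs d) (removeBlobs d') ∧
      ∀ u ∈ c, u.1 = 0 ∨ u.2 = 0 := by
  obtain ⟨c, c', h1, h2, h3, h4⟩ := new_loops hn (List.finRange n)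
    (s := d.1.toStrands.juxt d'.1.toStrands)
    (t := (removeBlobs d).1.toStrands.juxt (removeBlobs d').1.toStrands)
    (Diagram.good_juxt d.2 d'.2) rfl (Diagram.fresh d.1 d'.1) (List.pairwise_lt_finRange n)
    (fun i hi => absurd (List.mem_finRange i) hi) (fun x => Diagram.juxt_ne _ _ _)
  refine ⟨c, h1, ?_, h4⟩
  rw [h3]
  refine (congrArg Multiset.card (h2.trans ?_)).symm
  exact (zero_add _)

end LRDiagram

/-! ### The map to the Temperley-Lieb algebra -/

section
variable {k : Type*} [CommRing k] {n : ℕ}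

/-- The value of a closed loop with the given numbers of blobs, when `δ = κL = κR` and
`δL = δR = κLR = 1`: it is `1` for a loop with both kinds of blobs, and `δ` otherwise. -/
def loopValue (δ : k) (t : ℕ × ℕ) : k := if t.1 = 0 ∨ t.2 = 0 then δ else 1

namespace LRDiagram

/-- Removing all blobs, with each closed loop replaced by its value, is multiplicative. -/
noncomputable def toTL (hn : Odd n) (δ : k) : LRDiagram n →* TemperleyLieb k n δ where
  toFun d := (d.1.loops.map (loopValue δ)).prod • TemperleyLieb.diagram (removeBlobs d)
  map_one' := (congrArg (· • _) (by simp [Diagram.one_loops])).trans (one_smul k _)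
  map_mul' d d' := by
    obtain ⟨c, h1, h2, h3⟩ := mul_loops hn d d'
    have hc : (c.map (loopValue δ)).prod =
        δ ^ TLDiagram.numLoops (removeBlobs d) (removeBlobs d') := by
      have hc' : c.map (loopValue δ) = c.map fun _ => δ :=
        Multiset.map_congr rfl fun u hu => if_pos (h3 u hu)
      rw [← h2, hc', Multiset.map_const', Multiset.prod_replicate]
    have hm : TemperleyLieb.diagram (δ := δ) (removeBlobs d) *
        TemperleyLieb.diagram (removeBlobs d') =
        δ ^ TLDiagram.numLoops (removeBlobs d) (removeBlobs d') •
          TemperleyLieb.diagram (TLDiagram.comp (removeBlobs d) (removeBlobs d')) :=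
      TemperleyLieb.mulMap_diagram _ _
    rw [smul_mul_smul_comm, hm, h1, Multiset.map_add, Multiset.map_add, Multiset.prod_add,
      Multiset.prod_add, hc, removeBlobs_mul, smul_smul]

lemma toTL_apply (hn : Odd n) (δ : k) (d : LRDiagram n) : toTL hn δ d =
    (d.1.loops.map (loopValue δ)).prod • TemperleyLieb.diagram (removeBlobs d) := rfl

lemma toTL_addLoops (hn : Odd n) (δ : k) (t : ℕ × ℕ) (d : LRDiagram n) :
    toTL hn δ (addLoops {t} d) = loopValue δ t • toTL hn δ d := by
  have h1 : (addLoops {t} d).1.loops = d.1.loops + {t} := rfl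
  have h2 : removeBlobs (addLoops {t} d) = removeBlobs d := rfl
  rw [toTL_apply, toTL_apply, h1, h2, smul_smul]
  simp [mul_comm]

/-- Diagrams with the same pairing and the same loops have the same image. -/
lemma toTL_congr (hn : Odd n) (δ : k) {d d' : LRDiagram n} (h : d.1.next = d'.1.next)
    (hl : d.1.loops = d'.1.loops) : toTL hn δ d = toTL hn δ d' := by
  have : removeBlobs d = removeBlobs d' := by
    apply Subtype.ext
    apply Diagram.ext'
    ext1
    · exact h
    · rfl
    · rfl
  rw [toTL_apply, toTL_apply, hl, this]

end LRDiagram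

/-- The algebra map from the symplectic blob algebra to the Temperley-Lieb algebra that removes all
blobs. -/
noncomputable def SymplecticBlob.toTL (hn : Odd n) (δ : k) :
    SymplecticBlob n δ 1 1 δ δ 1 →ₐ[k] TemperleyLieb k n δ :=
  RingQuot.liftAlgHom k ⟨MonoidAlgebra.lift k (TemperleyLieb k n δ) (LRDiagram n)
    (LRDiagram.toTL hn δ), by
    have hs : ∀ (d d' : LRDiagram n) (c : k),
        LRDiagram.toTL hn δ d = c • LRDiagram.toTL hn δ d' →
        MonoidAlgebra.lift k (TemperleyLieb k n δ) (LRDiagram n) (LRDiagram.toTL hn δ)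
          (MonoidAlgebra.of k _ d) =
        MonoidAlgebra.lift k (TemperleyLieb k n δ) (LRDiagram n) (LRDiagram.toTL hn δ)
          (c • MonoidAlgebra.of k _ d') := by
      intro d d' c h
      rw [map_smul, MonoidAlgebra.lift_of, MonoidAlgebra.lift_of, h]
    intro a b hab
    cases hab with
    | strand d d' x u v w w' c hrule hd hd' hword hnext hloops =>
      apply hs
      have hc : c = 1 := by cases hrule <;> rfl
      rw [hc, one_smul, LRDiagram.toTL_congr hn δ hnext hloops]
    | loop d t c hrule =>
      apply hs
      rw [LRDiagram.toTL_addLoops]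
      cases hrule <;> simp [loopValue]
    | loopLL d i j =>
      apply hs
      simp [LRDiagram.toTL_addLoops, loopValue]
    | loopRR d i j =>
      apply hs
      simp [LRDiagram.toTL_addLoops, loopValue]⟩

lemma SymplecticBlob.toTL_diagram (hn : Odd n) (δ : k) (d : LRDiagram n) :
    toTL hn δ (diagram δ 1 1 δ δ 1 d) = LRDiagram.toTL hn δ d := by
  rw [toTL, diagram, RingQuot.liftAlgHom_mkAlgHom_apply, MonoidAlgebra.lift_of]

end

/-! ### Multiplication by the diagram `e` -/

namespace Diagram
variable {n : ℕ}

/-- A walk at the `j`-th bottom endpoint of the first factor goes on in the second factor. -/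
lemma walk_down {d d' : Diagram n} {x : Point n ⊕ Point n} {j : Fin n} {w : List Blob}
    (h : (d.toStrands.juxt d'.toStrands).Walk (seam n) x (Sum.inl (Sum.inr j)) w) :
    (d.toStrands.juxt d'.toStrands).Walk (seam n) x (Sum.inr (d'.next (Sum.inl j)))
      (w ++ d'.word (Sum.inl j)) :=
  h.step (Or.inl (mem_seam j))

/-- A walk at the `j`-th top endpoint of the second factor goes on in the first factor. -/
lemma walk_up {d d' : Diagram n} {x : Point n ⊕ Point n} {j : Fin n} {w : List Blob}
    (h : (d.toStrands.juxt d'.toStrands).Walk (seam n) x (Sum.inr (Sum.inl j)) w) :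
    (d.toStrands.juxt d'.toStrands).Walk (seam n) x (Sum.inl (d.next (Sum.inr j)))
      (w ++ d.word (Sum.inr j)) :=
  h.step (Or.inr (mem_seam j))

/-- Multiplying by `e` from below inserts a left blob at the first bottom endpoint. -/
lemma mul_e (d : Diagram n) :
    (d * (LRDiagram.e n).1).next = d.next ∧ (d * (LRDiagram.e n).1).loops = d.loops ∧
      ∀ x, (d * (LRDiagram.e n).1).word x = (if pos x + 1 = 2 * n then [Blob.L] else []) ++
        d.word x ++ (if pos (d.next x) + 1 = 2 * n then [Blob.L] else []) := by
  have hb : ∀ j : Fin n, (if (j : ℕ) = 0 then [Blob.L] else []) =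
      if pos (Sum.inr j : Point n) + 1 = 2 * n then [Blob.L] else [] := by
    intro j
    congr 1
    simp only [pos, eq_iff_iff]
    omega
  have hfin : ∀ x z w, (d.toStrands.juxt (LRDiagram.e n).1.toStrands).Walk (seam n) x
      (Sum.inl z) w → (d.toStrands.juxt (LRDiagram.e n).1.toStrands).Walk (seam n) x
      (outer z) (w ++ if pos z + 1 = 2 * n then [Blob.L] else []) := by
    rintro x (j | j) w h
    · have : ¬ pos (Sum.inl j : Point n) + 1 = 2 * n := by simp only [pos]; omega
      rwa [if_neg this, List.append_nil]
    · rw [← hb]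
      exact walk_down h
  have hw : ∀ x, (d.toStrands.juxt (LRDiagram.e n).1.toStrands).Walk (seam n) (outer x)
      (outer (d.next x)) ((if pos x + 1 = 2 * n then [Blob.L] else []) ++
        d.word x ++ (if pos (d.next x) + 1 = 2 * n then [Blob.L] else [])) := by
    rintro (j | j)
    · have : ¬ pos (Sum.inl j : Point n) + 1 = 2 * n := by simp only [pos]; omega
      rw [if_neg this, List.nil_append]
      exact hfin _ _ _ .start
    · rw [← hb]
      exact hfin _ _ _ (walk_up .start)
  refine ⟨funext fun x => (mul_of_walk (hw x)).1, ?_, fun x => (mul_of_walk (hw x)).2⟩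
  have h0 : (LRDiagram.e n).1.loops = 0 := rfl
  rw [mul_loops_of_walk, h0, add_zero]
  exact fun i => ⟨Sum.inr i, _, Or.inr .start⟩

/-! ### Moving an exposed strand to the edge

If the strand at the `i`-th top endpoint is `L`-exposed and this is its first endpoint, then the `i`
endpoints to the left of it are joined among themselves, so that `i` is even. -/

lemma next_lt_of_reaches {d : Diagram n} {i : Fin n} (hr : d.Reaches pos 0 (Sum.inl i))
    (hi : (i : ℕ) < pos (d.next (Sum.inl i))) {x : Point n} (hx : pos x < i) :
    pos (d.next x) < i := by
  by_contra h
  have h1 : x ≠ Sum.inl i := by rintro rfl; simp [pos] at hx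
  have h2 : x ≠ d.next (Sum.inl i) := by rintro rfl; omega
  have h3 : pos (d.next x) ≠ i := by
    intro e
    have : d.next x = Sum.inl i := pos_injective e
    exact h2 (by rw [← this, d.next_next])
  have h4 : pos (Sum.inl i : Point n) = i := rfl
  have := hr x h1 h2 (by omega)
  omega

lemma eq_inl_of_pos_lt {i : Fin n} {x : Point n} (hx : pos x < i) :
    ∃ j : Fin n, x = Sum.inl j ∧ j < i := by
  rcases x with j | j
  · exact ⟨j, rfl, hx⟩
  · simp only [pos] at hx
    omega

lemma even_of_next_lt {d : Diagram n} {i : Fin n}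
    (h : ∀ x, pos x < i → pos (d.next x) < i) : Even (i : ℕ) := by
  by_contra hi
  obtain ⟨j, hj⟩ := exists_next_not_mem d.proper (Nat.not_even_iff_odd.mp hi)
    (ι := fun j : Fin i => (Sum.inl (Fin.castLE i.2.le j) : Point n))
    (fun a b e => by simpa using e) (fun j => d.next_ne _)
  obtain ⟨j', h1, h2⟩ := eq_inl_of_pos_lt (h (Sum.inl (Fin.castLE i.2.le j)) j.2)
  exact hj ⟨j', h2⟩ h1

variable (d : Diagram n) (i : Fin n)

/-- The diagram that agrees with `d` on the first `i` top endpoints (assumed to be joined among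
themselves), has a strand with blobs `u` from the `i`-th top endpoint to the first bottom endpoint,
arcs joining the next `i` (an even number) bottom endpoints in adjacent pairs, and vertical strands
to the right of all these. -/
def shift (hi : Even (i : ℕ)) (h : ∀ x, pos x < i → pos (d.next x) < i) (u : List Blob) :
    Diagram n where
  next
    | Sum.inl j =>
      if j < i then d.next (Sum.inl j) else if j = i then Sum.inr ⟨0, i.pos⟩ else Sum.inr j
    | Sum.inr j =>
      if (j : ℕ) = 0 then Sum.inl i
      else if hj : j ≤ i then
        if hj' : (j : ℕ) % 2 = 1 then Sum.inr ⟨j + 1, by grind⟩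
        else Sum.inr ⟨j - 1, by omega⟩
      else Sum.inl j
  word
    | Sum.inl j => if j < i then d.word (Sum.inl j) else if j = i then u else []
    | Sum.inr j => if (j : ℕ) = 0 then u.reverse else []
  loops := 0
  next_next := by
    rintro (j | j)
    · by_cases h1 : j < i
      · obtain ⟨j', h2, h3⟩ := eq_inl_of_pos_lt (h (Sum.inl j) h1)
        simp only [if_pos h1, h2, if_pos h3]
        rw [← h2, d.next_next]
      · by_cases h2 : j = i
        · simp [h2]
        · have h3 : (j : ℕ) ≠ 0 := by omega
          have h4 : ¬ j ≤ i := by omega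
          simp [h1, h2, h3, h4]
    · by_cases h1 : (j : ℕ) = 0
      · simp [h1, Fin.ext_iff]
      · by_cases h2 : j ≤ i
        · by_cases h3 : (j : ℕ) % 2 = 1
          · have h4 : (j : ℕ) + 1 ≤ i := by grind
            have h5 : ¬ ((j : ℕ) + 1) % 2 = 1 := by omega
            simp [h1, h2, h3, Fin.le_def, h4, h5]
          · have h4 : (j : ℕ) - 1 ≠ 0 := by omega
            have h5 : (j : ℕ) - 1 ≤ i := by omega
            have h6 : ((j : ℕ) - 1) % 2 = 1 := by omega
            have h7 : (j : ℕ) - 1 + 1 = j := by omega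
            simp only [h1, h2, h3, Fin.le_def, h4, h5, h6, h7, if_false, dif_pos, dif_neg,
              not_false_eq_true]
        · have h3 : ¬ j < i := by omega
          have h4 : j ≠ i := by omega
          simp [h1, h2, h3, h4]
  next_ne := by
    rintro (j | j)
    · have := d.next_ne (Sum.inl j)
      dsimp only
      split_ifs <;> simp [this]
    · dsimp only
      split_ifs <;> simp [Fin.ext_iff]
      omega
  word_next := by
    rintro (j | j)
    · by_cases h1 : j < i
      · obtain ⟨j', h2, h3⟩ := eq_inl_of_pos_lt (h (Sum.inl j) h1)
        simp only [if_pos h1, h2, if_pos h3]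
        rw [← h2, d.word_next]
      · by_cases h2 : j = i
        · simp [h2]
        · have h3 : (j : ℕ) ≠ 0 := by omega
          simp [h1, h2, h3]
    · by_cases h1 : (j : ℕ) = 0
      · simp [h1]
      · by_cases h2 : j ≤ i
        · by_cases h3 : (j : ℕ) % 2 = 1
          · simp [h1, h2, h3]
          · have h4 : (j : ℕ) - 1 ≠ 0 := by omega
            simp [h1, h2, h3, h4]
        · have h3 : ¬ j < i := by omega
          have h4 : j ≠ i := by omega
          simp [h1, h2, h3, h4]

/-- The pairing of `d`, with the first `i` (an even number) top endpoints joined in adjacent pairs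
instead. -/
def zigzagNext : Point n → Point n
  | Sum.inl j =>
    if hj : j < i then
      if hj' : (j : ℕ) % 2 = 0 then Sum.inl ⟨j + 1, by omega⟩ else Sum.inl ⟨j - 1, by omega⟩
    else d.next (Sum.inl j)
  | Sum.inr j => d.next (Sum.inr j)

lemma zigzagNext_of_le {x : Point n} (hx : ¬ pos x < i) :
    zigzagNext d i x = d.next x := by
  rcases x with j | j
  · exact dif_neg hx
  · rfl

lemma zigzagNext_of_lt {x : Point n} (hx : pos x < i) :
    (pos x % 2 = 0 ∧ pos (zigzagNext d i x) = pos x + 1) ∨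
      (pos x % 2 = 1 ∧ pos (zigzagNext d i x) + 1 = pos x) := by
  obtain ⟨j, rfl, hj⟩ := eq_inl_of_pos_lt hx
  by_cases h : (j : ℕ) % 2 = 0
  · left
    simp [zigzagNext, hj, h, pos]
  · right
    simp [zigzagNext, hj, h, pos]
    omega

/-- The diagram `d`, with the first `i` (an even number) top endpoints (assumed to be joined among
themselves) joined in adjacent pairs instead, by strands without blobs. -/
def zigzag (hi : Even (i : ℕ)) (h : ∀ x, pos x < i → pos (d.next x) < i) : Diagram n where
  next := zigzagNext d i
  word x := if pos x < i then [] else d.word x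
  loops := d.loops
  next_next x := by
    have hi' := Nat.even_iff.mp hi
    by_cases hx : pos x < i
    · have h1 := zigzagNext_of_lt d i hx
      have h2 := zigzagNext_of_lt d i (x := zigzagNext d i x) (by omega)
      exact pos_injective (by omega)
    · have h1 : ¬ pos (d.next x) < i := fun e => hx (by simpa [d.next_next] using h _ e)
      rw [zigzagNext_of_le d i hx, zigzagNext_of_le d i h1, d.next_next]
  next_ne x e := by
    by_cases hx : pos x < i
    · have := zigzagNext_of_lt d i hx
      rw [e] at this
      omega
    · rw [zigzagNext_of_le d i hx] at e
      exact d.next_ne x e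
  word_next x := by
    have hi' := Nat.even_iff.mp hi
    by_cases hx : pos x < i
    · have h1 := zigzagNext_of_lt d i hx
      rw [if_pos hx, if_pos (by omega)]
      rfl
    · have h1 : ¬ pos (d.next x) < i := fun e => hx (by simpa [d.next_next] using h _ e)
      rw [zigzagNext_of_le d i hx, if_neg hx, if_neg h1, d.word_next]

/-- In the product, the strand from the `i`-th top endpoint goes to the first point of the seam and
then from left to right through all the adjacent pairs, back to the `i`-th point. -/
lemma shift_mul_zigzag (hi : Even (i : ℕ)) (h : ∀ x, pos x < i → pos (d.next x) < i)
    (u : List Blob) (hd : (i : ℕ) < pos (d.next (Sum.inl i))) :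
    (shift d i hi h u * zigzag d i hi h).next = d.next ∧
      (shift d i hi h u * zigzag d i hi h).loops = d.loops ∧
      (shift d i hi h u * zigzag d i hi h).word (Sum.inl i) = u ++ d.word (Sum.inl i) ∧
      ∀ x, x ≠ Sum.inl i → x ≠ d.next (Sum.inl i) →
        (shift d i hi h u * zigzag d i hi h).word x = d.word x := by
  set A := shift d i hi h u with hA
  set B := zigzag d i hi h with hB
  have hi2 := Nat.even_iff.mp hi
  have hle : ∀ {x : Point n}, (i : ℕ) ≤ pos x → B.next x = d.next x ∧ B.word x = d.word x := fun hx =>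
    ⟨zigzagNext_of_le d i (by omega), if_neg (by omega)⟩
  have hA0 : ∀ {j : Fin n}, i < j → A.next (Sum.inl j) = Sum.inr j ∧ A.word (Sum.inl j) = [] := by
    intro j hj
    have h1 : ¬ j < i := by omega
    have h2 : j ≠ i := by omega
    simp [hA, shift, h1, h2]
  have zig1 : ∀ m (hm : m + 1 < n), m < i → m % 2 = 0 →
      ∀ {w : List Blob}, (A.toStrands.juxt B.toStrands).Walk (seam n) (outer (Sum.inl i))
        (Sum.inl (Sum.inr ⟨m, by omega⟩)) w →
      (A.toStrands.juxt B.toStrands).Walk (seam n) (outer (Sum.inl i))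
        (Sum.inr (Sum.inl ⟨m + 1, hm⟩)) w := by
    intro m hm h1 h2 w hw
    have e1 : B.next (Sum.inl ⟨m, by omega⟩) = Sum.inl ⟨m + 1, hm⟩ := by
      simp [hB, zigzag, zigzagNext, Fin.lt_def, h1, h2]
    have e2 : B.word (Sum.inl ⟨m, by omega⟩) = [] := if_pos h1
    have := walk_down hw
    rwa [e1, e2, List.append_nil] at this
  have zig : ∀ m (hm : m < n), m ≤ i → m % 2 = 0 →
      (A.toStrands.juxt B.toStrands).Walk (seam n) (outer (Sum.inl i))
        (Sum.inl (Sum.inr ⟨m, hm⟩)) u := by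
    intro m
    induction m using Nat.twoStepInduction with
    | zero =>
      intro hm _ _
      have := Walk.start (s := A.toStrands.juxt B.toStrands) (l := seam n)
        (x := outer (Sum.inl i))
      simpa [outer, Strands.juxt, hA, shift] using this
    | one => intro _ _ h1; simp at h1
    | more m ih _ =>
      intro hm h1 h2
      have hw := zig1 m (by omega) (by omega) (by omega) (ih (by omega) (by omega) (by omega))
      have h3 : (m + 1) % 2 = 1 := by omega
      have h5 : (⟨m + 1, by omega⟩ : Fin n) ≤ i := Fin.le_def.mpr (by simp only; omega)
      have e1 : A.next (Sum.inr ⟨m + 1, by omega⟩) = Sum.inr ⟨m + 1 + 1, hm⟩ := by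
        simp [hA, shift, h3, h5]
      have e2 : A.word (Sum.inr ⟨m + 1, by omega⟩) = [] := by
        simp [hA, shift]
      have := walk_up hw
      rwa [e1, e2, List.append_nil] at this
  have fin : ∀ {x : Point n ⊕ Point n} {z : Point n} {w : List Blob}, (i : ℕ) < pos z →
      (A.toStrands.juxt B.toStrands).Walk (seam n) x (Sum.inr z) w →
      (A.toStrands.juxt B.toStrands).Walk (seam n) x (outer z) w := by
    rintro x (j | j) w hz hw
    · have h1 : ¬ (j : ℕ) = 0 := by simp only [pos] at hz; omega
      have h2 : ¬ j ≤ i := by simp only [pos] at hz; omega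
      have e1 : A.next (Sum.inr j) = Sum.inl j := by simp [hA, shift, h1, h2]
      have e2 : A.word (Sum.inr j) = [] := by simp [hA, shift, h1]
      have := walk_up hw
      rwa [e1, e2, List.append_nil] at this
    · exact hw
  -- the strand at the `i`-th top endpoint
  have main := mul_of_walk (fin hd (by
    have := walk_down (zig i i.2 le_rfl hi2)
    rwa [(hle (x := Sum.inl i) le_rfl).1, (hle (x := Sum.inl i) le_rfl).2] at this))
  have rest : ∀ x, x ≠ Sum.inl i → x ≠ d.next (Sum.inl i) →
      (A * B).next x = d.next x ∧ (A * B).word x = d.word x := by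
    intro x h1 h2
    by_cases hx : pos x < i
    · obtain ⟨j, rfl, hj⟩ := eq_inl_of_pos_lt hx
      obtain ⟨j', hj1, hj2⟩ := eq_inl_of_pos_lt (h _ hx)
      have := Walk.start (s := A.toStrands.juxt B.toStrands) (l := seam n)
        (x := outer (Sum.inl j))
      have e1 : A.next (Sum.inl j) = Sum.inl j' := by simp [hA, shift, hj, hj1]
      have e2 : A.word (Sum.inl j) = d.word (Sum.inl j) := by simp [hA, shift, hj]
      simp only [outer, Strands.juxt, Sum.map_inl, Sum.elim_inl, e1, e2] at this
      rw [hj1]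
      exact mul_of_walk this
    · have h3 : (i : ℕ) ≠ pos x := fun e => h1 (pos_injective e.symm)
      have h4 : (i : ℕ) ≠ pos (d.next x) := fun e => h2 (by
        have : d.next x = Sum.inl i := pos_injective e.symm
        rw [← this, d.next_next])
      have h5 : ¬ pos (d.next x) < i := fun e => hx (by simpa [d.next_next] using h _ e)
      have e := hle (x := x) (by omega)
      refine mul_of_walk (fin (by omega) ?_)
      rw [← e.1, ← e.2]
      rcases x with j | j
      · have e1 := hA0 (j := j) (by simp only [pos] at hx h3; omega)
        have := Walk.start (s := A.toStrands.juxt B.toStrands) (l := seam n)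
          (x := outer (Sum.inl j))
        simp only [outer, Strands.juxt, Sum.map_inl, Sum.elim_inl, e1.1, e1.2] at this
        exact walk_down this
      · exact .start
  refine ⟨funext fun x => ?_, ?_, main.2, fun x h1 h2 => (rest x h1 h2).2⟩
  · by_cases h1 : x = Sum.inl i
    · rw [h1, main.1]
    · by_cases h2 : x = d.next (Sum.inl i)
      · rw [h2, d.next_next, ← main.1, (A * B).next_next]
      · exact (rest x h1 h2).1
  · have h0 : A.loops = 0 := rfl
    have h0' : B.loops = d.loops := rfl
    rw [mul_loops_of_walk, h0, h0', zero_add]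
    intro j
    by_cases h1 : j ≤ i
    · by_cases h2 : (j : ℕ) % 2 = 0
      · exact ⟨Sum.inl i, u, Or.inl (zig j j.2 h1 h2)⟩
      · refine ⟨Sum.inl i, u, Or.inr ?_⟩
        have h3 : (j : ℕ) - 1 + 1 = j := by omega
        have := zig1 (j - 1) (by omega) (by omega) (by omega)
          (zig (j - 1) (by omega) (by omega) (by omega))
        simpa only [h3] using this
    · have := Walk.start (s := A.toStrands.juxt B.toStrands) (l := seam n)
        (x := outer (Sum.inl j))
      simp only [outer, Strands.juxt, Sum.map_inl, Sum.elim_inl, (hA0 (not_le.mp h1)).1] at this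
      exact ⟨Sum.inl j, _, Or.inl this⟩

lemma shift_mul_e (hi : Even (i : ℕ)) (h : ∀ x, pos x < i → pos (d.next x) < i) :
    shift d i hi h [] * (LRDiagram.e n).1 = shift d i hi h [Blob.L] := by
  obtain ⟨h1, h2, h3⟩ := mul_e (shift d i hi h [])
  apply ext'
  ext1
  · exact h1
  · funext x
    refine (h3 x).trans ?_
    have hn := i.2
    rcases x with j | j
    · by_cases h4 : j < i
      · have h5 := h (Sum.inl j) h4
        have h6 : ¬ pos (d.next (Sum.inl j)) + 1 = 2 * n := by omega
        have h7 : ¬ (j : ℕ) + 1 = 2 * n := by omega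
        simpa [shift, h4, h7, pos] using h6
      · have h7 : ¬ (j : ℕ) + 1 = 2 * n := by omega
        by_cases h5 : j = i
        · subst h5
          have h6 : 2 * n - 1 + 1 = 2 * n := by omega
          simp [shift, pos, h7, h6]
        · have h6 : ¬ 2 * n - 1 - j + 1 = 2 * n := by omega
          simp [shift, h4, h5, h6, h7, pos]
    · by_cases h4 : (j : ℕ) = 0
      · have h5 : ¬ (i : ℕ) + 1 = 2 * n := by omega
        have h6 : 2 * n - 1 + 1 = 2 * n := by omega
        simp [shift, h4, pos, h5, h6]
      · have h5 : ¬ 2 * n - 1 - j + 1 = 2 * n := by omega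
        have h6 : ¬ (j : ℕ) + 1 = 2 * n := by omega
        by_cases h7 : j ≤ i
        · by_cases h8 : (j : ℕ) % 2 = 1
          · have h9 : ¬ 2 * n - 1 - (j + 1) + 1 = 2 * n := by omega
            simp [shift, h4, pos, h5, h7, h8, h9]
          · have h9 : ¬ 2 * n - 1 - (j - 1) + 1 = 2 * n := by omega
            simp [shift, h4, pos, h5, h7, h8, h9]
        · simp [shift, h4, pos, h5, h6, h7]
  · exact h2

lemma pos_shift_next (hi : Even (i : ℕ)) (h : ∀ x, pos x < i → pos (d.next x) < i)
    (u : List Blob) (x : Point n) :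
    (pos x < i ∧ pos ((shift d i hi h u).next x) = pos (d.next x)) ∨
      (pos x = i ∧ pos ((shift d i hi h u).next x) + 1 = 2 * n) ∨
      (i < pos x ∧ pos x + i + 1 < 2 * n ∧
        pos ((shift d i hi h u).next x) + pos x + 1 = 2 * n) ∨
      (2 * n ≤ pos x + i + 1 ∧ pos x + 1 < 2 * n ∧ pos x % 2 = 0 ∧
        pos ((shift d i hi h u).next x) + 1 = pos x) ∨
      (2 * n ≤ pos x + i + 1 ∧ pos x + 1 < 2 * n ∧ pos x % 2 = 1 ∧
        pos ((shift d i hi h u).next x) = pos x + 1) ∨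
      (pos x + 1 = 2 * n ∧ pos ((shift d i hi h u).next x) = i) := by
  have hn := i.2
  rcases x with j | j
  · by_cases h4 : j < i
    · left
      simp [shift, h4, pos]
    · by_cases h5 : j = i
      · right; left
        subst h5
        simp [shift, pos]
        omega
      · right; right; left
        simp [shift, h4, h5, pos]
        omega
  · by_cases h4 : (j : ℕ) = 0
    · right; right; right; right; right
      simp [shift, h4, pos]
      omega
    · by_cases h7 : j ≤ i
      · by_cases h8 : (j : ℕ) % 2 = 1
        · right; right; right; left
          simp [shift, h4, pos, h7, h8]
          omega
        · right; right; right; right; left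
          simp [shift, h4, pos, h7, h8]
          omega
      · right; right; left
        simp [shift, h4, pos, h7]
        omega

variable {d i}

lemma shift_isLeftRight (hn : Odd n) (hd : d.IsLeftRight) (hi : Even (i : ℕ))
    (h : ∀ x, pos x < i → pos (d.next x) < i) : (shift d i hi h []).IsLeftRight := by
  have hi2 := Nat.even_iff.mp hi
  have hin := i.2
  have hword : ∀ x g, g ∈ (shift d i hi h []).word x →
      pos x < i ∧ (shift d i hi h []).next x = d.next x ∧ g ∈ d.word x := by
    rintro (j | j) g hg
    · by_cases h1 : j < i
      · refine ⟨h1, ?_, ?_⟩ <;> simp_all [shift]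
      · simp [shift, h1] at hg
    · simp [shift] at hg
  refine ⟨?_, ?_, ?_⟩
  · intro c x hc hc'
    have k1 : pos x ≠ pos c := fun e => hc (pos_injective e)
    have k2 : pos x ≠ pos ((shift d i hi h []).next c) := fun e => hc' (pos_injective e)
    have l1 := pos_lt c
    have l2 := pos_lt x
    have a1 := h c
    have a2 := h x
    have p1 := pos_shift_next d i hi h [] c
    have p2 := pos_shift_next d i hi h [] x
    have p0 : x ≠ d.next c → _ := hd.planar c x hc
    by_cases h1 : pos c < i
    · by_cases h2 : pos x < i
      · have := p0 fun e => k2 (by rw [e]; omega)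
        omega
      · omega
    · rcases p1 with p1 | p1 | p1 | p1 | p1 | p1 <;> rcases p2 with p2 | p2 | p2 | p2 | p2 | p2 <;>
        omega
  · intro x hx
    obtain ⟨h1, h2, h3⟩ := hword x _ hx
    intro c hc hc' hlt
    rw [h2] at hc'
    have p1 := pos_shift_next d i hi h [] c
    have := hd.left x h3 c hc hc'
    omega
  · intro x hx
    obtain ⟨h1, -, h3⟩ := hword x _ hx
    -- a strand from top to bottom separates the first `i` top endpoints from the right edge
    exfalso
    obtain ⟨t, ht1, ht2⟩ := d.exists_through hn
    have a1 := h t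
    have a2 := h x h1
    have := hd.right x h3 t (by rintro rfl; omega)
      (by rintro rfl; rw [d.next_next] at ht2; omega) (by omega)
    omega

lemma zigzag_isLeftRight (hd : d.IsLeftRight) (hi : Even (i : ℕ))
    (h : ∀ x, pos x < i → pos (d.next x) < i) : (zigzag d i hi h).IsLeftRight := by
  have hi2 := Nat.even_iff.mp hi
  have hin := i.2
  have h' : ∀ x, ¬ pos x < i → ¬ pos (d.next x) < i := fun x hx e =>
    hx (by simpa [d.next_next] using h _ e)
  have hword : ∀ x g, g ∈ (zigzag d i hi h).word x → ¬ pos x < i ∧ g ∈ d.word x := by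
    intro x g hg
    by_cases hx : pos x < i
    · simp [zigzag, hx] at hg
    · exact ⟨hx, by simpa [zigzag, hx] using hg⟩
  have hlt : ∀ x, pos x < i → (pos x % 2 = 0 ∧ pos ((zigzag d i hi h).next x) = pos x + 1) ∨
      (pos x % 2 = 1 ∧ pos ((zigzag d i hi h).next x) + 1 = pos x) := fun x hx =>
    zigzagNext_of_lt d i hx
  have hle : ∀ x, ¬ pos x < i → (zigzag d i hi h).next x = d.next x := fun x hx =>
    zigzagNext_of_le d i hx
  refine ⟨?_, ?_, ?_⟩
  · intro c x hc hc'
    have k1 : pos x ≠ pos c := fun e => hc (pos_injective e)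
    have k2 : pos x ≠ pos ((zigzag d i hi h).next c) := fun e => hc' (pos_injective e)
    have a1 := h' c
    have a2 := h' x
    by_cases h1 : pos c < i
    · have p1 := hlt c h1
      by_cases h2 : pos x < i
      · have p2 := hlt x h2
        omega
      · rw [hle x h2]
        omega
    · rw [hle c h1] at hc' ⊢
      have := hd.planar c x hc hc'
      by_cases h2 : pos x < i
      · have p2 := hlt x h2
        omega
      · rwa [hle x h2]
  · intro x hx c hc hc' hcl
    obtain ⟨h1, h2⟩ := hword x _ hx
    rw [hle x h1] at hc'
    by_cases h3 : pos c < i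
    · have := hlt c h3
      omega
    · rw [hle c h3] at hcl ⊢
      exact hd.left x h2 c hc hc' hcl
  · intro x hx c hc hc' hcl
    obtain ⟨h1, h2⟩ := hword x _ hx
    rw [hle x h1] at hc'
    by_cases h3 : pos c < i
    · have := hlt c h3
      omega
    · rw [hle c h3] at hcl ⊢
      exact hd.right x h2 c hc hc' hcl

/-- Diagrams are equal if they have the same pairing, loops and words, where of the two words of one
strand only one needs to be compared. -/
lemma ext_of_word {d d' : Diagram n} (x : Point n) (hnext : d.next = d'.next)
    (hloops : d.loops = d'.loops) (hx : d.word x = d'.word x)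
    (hword : ∀ y, y ≠ x → y ≠ d.next x → d.word y = d'.word y) : d = d' := by
  apply ext'
  ext1
  · exact hnext
  · funext y
    by_cases h1 : y = x
    · rw [h1, hx]
    · by_cases h2 : y = d.next x
      · rw [h2, d.word_next, hnext, d'.word_next, hx]
      · exact hword y h1 h2
  · exact hloops

/-- A left blob at the beginning of the strand at a top endpoint comes from a factor `e`. -/
lemma exists_mul_e_mul (hn : Odd n) {d' : Diagram n} (hd : d.IsLeftRight) (hd' : d'.IsLeftRight)
    (hnext : d.next = d'.next) (hloops : d.loops = d'.loops)
    (hi : d.word (Sum.inl i) = Blob.L :: d'.word (Sum.inl i))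
    (hword : ∀ x, x ≠ Sum.inl i → x ≠ d.next (Sum.inl i) → d.word x = d'.word x)
    (hlt : (i : ℕ) < pos (d.next (Sum.inl i))) :
    ∃ A B : LRDiagram n, d = (A * LRDiagram.e n * B).1 ∧ d' = (A * B).1 := by
  have hr : d'.Reaches pos 0 (Sum.inl i) := by
    intro c
    rw [← hnext]
    exact hd.left (Sum.inl i) (by simp [hi]) c
  rw [hnext] at hlt hword
  have h : ∀ x, pos x < i → pos (d'.next x) < i := fun x => next_lt_of_reaches hr hlt
  have he := even_of_next_lt h
  refine ⟨⟨_, shift_isLeftRight hn hd' he h⟩, ⟨_, zigzag_isLeftRight hd' he h⟩, ?_, ?_⟩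
  · change d = shift d' i he h [] * (LRDiagram.e n).1 * zigzag d' i he h
    rw [shift_mul_e]
    obtain ⟨h1, h2, h3, h4⟩ := shift_mul_zigzag d' i he h [Blob.L] hlt
    exact ext_of_word (Sum.inl i) (hnext.trans h1.symm) (hloops.trans h2.symm) (hi.trans h3.symm)
      fun x a b => (hword x a (by rwa [← hnext])).trans (h4 x a (by rwa [← hnext])).symm
  · change d' = shift d' i he h [] * zigzag d' i he h
    obtain ⟨h1, h2, h3, h4⟩ := shift_mul_zigzag d' i he h [] hlt
    exact ext_of_word (Sum.inl i) h1.symm h2.symm h3.symm fun x a b => (h4 x a b).symm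

end Diagram

/-! ### Reflections of diagrams -/

namespace Strands
variable {X : Type} [DecidableEq X]

lemma gluePairs_reverse {l : List (X × X)} : ∀ {s : Strands X}, s.Proper → s.Fresh l →
    s.gluePairs l.reverse = s.gluePairs l := by
  induction l with
  | nil => intro s _ _; rfl
  | cons pq l ih =>
    intro s h hF
    have hF' : s.Fresh l := by
      obtain ⟨h1, h2⟩ := hF
      rw [ends_cons] at h1 h2
      exact ⟨h1.of_cons.of_cons, fun x hx => h2 x (by simp [hx])⟩
    rw [List.reverse_cons, gluePairs_append, ih h hF', gluePairs_cons s, gluePairs_glue h hF]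
    rfl

end Strands

/-- Exchange left and right blobs. -/
def Blob.swap : Blob → Blob
  | L => R
  | R => L

lemma Blob.swap_swap : ∀ g : Blob, g.swap.swap = g := by
  rintro (_ | _) <;> rfl

lemma loopType_map_swap (w : List Blob) : loopType (w.map Blob.swap) = (loopType w).swap := by
  induction w with
  | nil => rfl
  | cons g w ih =>
    have h : ∀ (g : Blob) (w : List Blob), loopType (g :: w) = loopType [g] + loopType w :=
      fun g w => loopType_append [g] w
    rw [List.map_cons, h, h g, ih, Prod.swap_add]
    congr 1
    cases g <;> rfl

namespace Strands
variable {X : Type}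

/-- Exchange left and right blobs on all strands and loops. -/
def swapBlobs (s : Strands X) : Strands X where
  next := s.next
  word x := (s.word x).map Blob.swap
  loops := s.loops.map Prod.swap

@[simp] lemma swapBlobs_next (s : Strands X) : s.swapBlobs.next = s.next := rfl

@[simp] lemma swapBlobs_word (s : Strands X) (x : X) :
    s.swapBlobs.word x = (s.word x).map Blob.swap := rfl

@[simp] lemma swapBlobs_loops (s : Strands X) : s.swapBlobs.loops = s.loops.map Prod.swap := rfl

lemma swapBlobs_gluePairs [DecidableEq X] (l : List (X × X)) : ∀ s : Strands X,
    s.swapBlobs.gluePairs l = (s.gluePairs l).swapBlobs := by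
  induction l with
  | nil => intro s; rfl
  | cons pq l ih =>
    intro s
    rw [gluePairs_cons, gluePairs_cons, ← ih]
    congr 1
    ext1
    · rfl
    · funext x
      by_cases h1 : x = pq.1 ∨ x = pq.2
      · simp [Strands.glue, h1]
      · by_cases h2 : s.next x = pq.1
        · simp [Strands.glue, h1, h2]
        · by_cases h3 : s.next x = pq.2
          · have h4 : pq.2 ≠ pq.1 := h3 ▸ h2
            simp [Strands.glue, h1, h3, h4]
          · simp [Strands.glue, h1, h2, h3]
    · by_cases h1 : s.next pq.1 = pq.2 <;> simp [Strands.glue, h1, loopType_map_swap]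

end Strands

/-- The reflection of the endpoints at a vertical axis. -/
def mirror {n : ℕ} (x : Point n) : Point n := Sum.map Fin.rev Fin.rev x

lemma mirror_mirror {n : ℕ} (x : Point n) : mirror (mirror x) = x := by
  rcases x with x | x <;> simp [mirror]

lemma pos_swap {n : ℕ} (x : Point n) : pos x.swap + pos x + 1 = 2 * n := by
  rcases x with x | x <;> simp only [pos, Sum.swap_inl, Sum.swap_inr] <;> omega

lemma pos_mirror {n : ℕ} (x : Point n) :
    (pos x < n ∧ pos (mirror x) + pos x + 1 = n) ∨
      (n ≤ pos x ∧ n ≤ pos (mirror x) ∧ pos (mirror x) + pos x + 1 = 3 * n) := by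
  rcases x with x | x <;> simp only [mirror, pos, Sum.map_inl, Sum.map_inr, Fin.val_rev] <;> omega

namespace Diagram
variable {n : ℕ}

/-- The reflection of a diagram at a horizontal axis. -/
def vflip (d : Diagram n) : Diagram n where
  next x := (d.next x.swap).swap
  word x := d.word x.swap
  loops := d.loops
  next_next x := by simp [d.next_next]
  next_ne x h := d.next_ne x.swap (by rw [← Sum.swap_swap (d.next x.swap), h])
  word_next x := by simp [d.word_next]

/-- The reflection of a diagram at a vertical axis, which exchanges left and right blobs. -/
def hflip (d : Diagram n) : Diagram n where
  next x := mirror (d.next (mirror x))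
  word x := (d.word (mirror x)).map Blob.swap
  loops := d.loops.map Prod.swap
  next_next x := by simp [d.next_next, mirror_mirror]
  next_ne x h := d.next_ne (mirror x) (by rw [← mirror_mirror (d.next (mirror x)), h])
  word_next x := by simp [d.word_next, mirror_mirror]

lemma vflip_vflip (d : Diagram n) : d.vflip.vflip = d := by
  apply ext'
  ext1
  · funext x; simp [vflip]
  · funext x; simp [vflip]
  · rfl

lemma hflip_hflip (d : Diagram n) : d.hflip.hflip = d := by
  apply ext'
  ext1
  · funext x; simp [hflip, mirror_mirror]
  · funext x
    simp [hflip, mirror_mirror, Function.comp_def, Blob.swap_swap]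
  · simp [hflip]

/-- If the juxtapositions of two pairs of diagrams, glued along the seam, are identified by a map
compatible with a map `ρ` of endpoints, then `ρ` identifies the products. -/
lemma sim_mul_of_sim_gluePairs {a b a' b' : Diagram n} {φ : Point n ⊕ Point n → Point n ⊕ Point n}
    {ρ : Point n → Point n} (hφ : ∀ x, φ (outer x) = outer (ρ x))
    (h : Sim φ 0 ((a.toStrands.juxt b.toStrands).gluePairs (seam n))
      ((a'.toStrands.juxt b'.toStrands).gluePairs (seam n))) :
    Sim ρ 0 (a * b).toStrands (a' * b').toStrands := by
  refine ⟨fun x => outer_injective ?_, fun x => ?_, h.loops⟩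
  · rw [mul_toStrands, ← outer_next, ← hφ, h.next, outer_next, hφ]
    rfl
  · have h1 := h.word (outer x)
    rwa [hφ] at h1

lemma vflip_mul (d d' : Diagram n) : (d * d').vflip = d'.vflip * d.vflip := by
  have h0 : Sim (fun x => (Sum.map Sum.swap Sum.swap x).swap : Point n ⊕ Point n → _) 0
      (d.toStrands.juxt d'.toStrands) (d'.vflip.toStrands.juxt d.vflip.toStrands) := by
    refine ⟨?_, ?_, ?_⟩
    · rintro (x | x) <;> simp [Strands.juxt, vflip]
    · rintro (x | x) <;> simp [Strands.juxt, vflip]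
    · simp [Strands.juxt, vflip, add_comm]
  have h1 := h0.gluePairs (l := seam n) (by
    rintro ((x | x) | (x | x)) ((y | y) | (y | y)) e <;> simp_all)
  have hs : (seam n).map (Prod.map (fun x => (Sum.map Sum.swap Sum.swap x).swap)
      fun x => (Sum.map Sum.swap Sum.swap x).swap) =
      (List.finRange n).map fun i => (Sum.inr (Sum.inl i), Sum.inl (Sum.inr i)) := by
    simp [seam]
  have hg := gluePairs_symm (fun i => (Sum.inl (Sum.inr i) : Point n ⊕ Point n))
    (fun i => Sum.inr (Sum.inl i)) (List.finRange n) (d'.vflip.proper.juxt d.vflip.proper)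
    (fresh d'.vflip d.vflip)
  rw [hs, ← hg] at h1
  have h2 := sim_mul_of_sim_gluePairs (ρ := Sum.swap) (by rintro (x | x) <;> rfl) h1
  apply ext'
  ext1
  · funext x
    have := h2.next x.swap
    rw [Sum.swap_swap] at this
    exact this.symm
  · funext x
    have := h2.word x.swap
    rw [Sum.swap_swap] at this
    exact this.symm
  · exact (h2.loops.trans (add_zero _)).symm

lemma hflip_mul (d d' : Diagram n) : (d * d').hflip = d.hflip * d'.hflip := by
  have h0 : Sim (Sum.map mirror mirror : Point n ⊕ Point n → _) 0
      (d.toStrands.juxt d'.toStrands).swapBlobs (d.hflip.toStrands.juxt d'.hflip.toStrands) := by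
    refine ⟨?_, ?_, ?_⟩
    · rintro (x | x) <;> simp [Strands.juxt, hflip, swapBlobs, mirror_mirror]
    · rintro (x | x) <;> simp [Strands.juxt, hflip, swapBlobs, mirror_mirror]
    · simp [Strands.juxt, hflip, swapBlobs]
  have hm : Function.Injective (mirror (n := n)) := fun x y e => by
    rw [← mirror_mirror x, e, mirror_mirror]
  have h1 := h0.gluePairs (l := seam n) (hm.sumMap hm)
  have hs : (seam n).map (Prod.map (Sum.map mirror mirror) (Sum.map mirror mirror)) =
      (seam n).reverse := by
    simp [seam, ← List.map_reverse, List.finRange_reverse, mirror]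
  rw [hs, gluePairs_reverse (d.hflip.proper.juxt d'.hflip.proper) (fresh d.hflip d'.hflip),
    swapBlobs_gluePairs] at h1
  apply ext'
  ext1
  · funext x
    apply outer_injective
    have h2 := h1.next (outer (mirror x))
    have h3 : ∀ x : Point n, Sum.map mirror mirror (outer x) = outer (mirror x) := by
      rintro (x | x) <;> rfl
    rw [h3, mirror_mirror, outer_next] at h2
    refine Eq.trans ?_ h2.symm
    change _ = Sum.map mirror mirror (((d.toStrands.juxt d'.toStrands).gluePairs (seam n)).next
      (outer (mirror x)))
    rw [outer_next, h3]
    rfl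
  · funext x
    have h2 := h1.word (outer (mirror x))
    have h3 : ∀ x : Point n, Sum.map mirror mirror (outer x) = outer (mirror x) := by
      rintro (x | x) <;> rfl
    rw [h3, mirror_mirror] at h2
    exact h2.symm
  · exact (h1.loops.trans (add_zero _)).symm

lemma IsLeftRight.vflip {d : Diagram n} (h : d.IsLeftRight) : d.vflip.IsLeftRight := by
  have hp := pos_swap (n := n)
  have hr : ∀ z x, z = 0 ∨ z = n → d.Reaches pos z x.swap → d.vflip.Reaches pos z x := by
    intro z x hz hr c h1 h2 h3
    have h4 := hr (d.next c.swap) (fun e => h2 (by simp [Diagram.vflip, ← e, d.next_next]))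
      (fun e => h1 (Function.LeftInverse.injective Sum.swap_swap (d.proper.inj e)))
    rw [d.next_next] at h4
    have h5 : d.vflip.next c = (d.next c.swap).swap := rfl
    rw [h5] at h3 ⊢
    have p1 := hp c
    have p2 := hp (d.next c.swap)
    have p3 := hp x
    omega
  refine ⟨?_, fun x hx => hr 0 x (Or.inl rfl) (h.left _ hx),
    fun x hx => hr n x (Or.inr rfl) (h.right _ hx)⟩
  intro c x h1 h2
  have h4 := h.planar (d.next c.swap) x.swap (fun e => h2 (by simp [Diagram.vflip, ← e]))
    (fun e => h1 (by rw [d.next_next] at e; simpa using congrArg Sum.swap e))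
  rw [d.next_next] at h4
  have h5 : ∀ c, d.vflip.next c = (d.next c.swap).swap := fun _ => rfl
  rw [h5, h5]
  have p1 := hp c
  have p2 := hp (d.next c.swap)
  have p3 := hp x
  have p4 := hp (d.next x.swap)
  omega

lemma IsLeftRight.hflip {d : Diagram n} (h : d.IsLeftRight) : d.hflip.IsLeftRight := by
  have hp := pos_mirror (n := n)
  have hne : ∀ {x y : Point n}, x ≠ y → pos x ≠ pos y := fun h e => h (pos_injective e)
  have hmm : ∀ {x y : Point n}, x ≠ mirror y → mirror x ≠ y := by
    rintro x y h rfl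
    exact h (mirror_mirror x).symm
  have hr : ∀ z x, z = 0 ∨ z = n → d.Reaches pos (n - z) (mirror x) →
      d.hflip.Reaches pos z x := by
    intro z x hz hr c h1 h2 h3
    have h5 : ∀ c, d.hflip.next c = mirror (d.next (mirror c)) := fun _ => rfl
    rw [h5] at h2 h3 ⊢
    have m1 : mirror c ≠ mirror x := hmm (by rwa [mirror_mirror])
    have m2 : mirror c ≠ d.next (mirror x) := hmm h2
    have m3 : d.next (mirror c) ≠ mirror x := fun e => m2 (by rw [← e, d.next_next])
    have m4 : d.next (mirror c) ≠ d.next (mirror x) := fun e => m1 (d.proper.inj e)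
    have h4 := hr (mirror c) m1 m2
    have h6 := hr (d.next (mirror c)) m3 m4
    rw [d.next_next] at h6
    have q1 := hne m1
    have q2 := hne m3
    have p1 := hp c
    have p2 := hp (d.next (mirror c))
    have p3 := hp x
    rcases hz with rfl | rfl <;> rcases p1 with p1 | p1 <;> rcases p2 with p2 | p2 <;>
      rcases p3 with p3 | p3 <;> omega
  have hL : ∀ x, Blob.L ∈ d.hflip.word x → Blob.R ∈ d.word (mirror x) := by
    intro x hx
    obtain ⟨g, hg, e⟩ := List.mem_map.mp hx
    cases g
    · cases e
    · exact hg
  have hR : ∀ x, Blob.R ∈ d.hflip.word x → Blob.L ∈ d.word (mirror x) := by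
    intro x hx
    obtain ⟨g, hg, e⟩ := List.mem_map.mp hx
    cases g
    · exact hg
    · cases e
  refine ⟨?_, fun x hx => hr 0 x (Or.inl rfl) (h.right _ (hL x hx)),
    fun x hx => hr n x (Or.inr rfl) (by simpa using h.left _ (hR x hx))⟩
  intro c x h1 h2
  have h5 : ∀ c, d.hflip.next c = mirror (d.next (mirror c)) := fun _ => rfl
  rw [h5] at h2 ⊢
  rw [h5]
  have m1 : mirror x ≠ mirror c := hmm (by rwa [mirror_mirror])
  have m2 : mirror x ≠ d.next (mirror c) := hmm h2
  have m3 : d.next (mirror x) ≠ mirror c := fun e => m2 (by rw [← e, d.next_next])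
  have m4 : d.next (mirror x) ≠ d.next (mirror c) := fun e => m1 (d.proper.inj e)
  have h4 := h.planar (mirror c) (mirror x) m1 m2
  have h6 := h.planar (d.next (mirror c)) (mirror x) m2 (by rwa [d.next_next])
  rw [d.next_next] at h6
  have q1 := hne m1
  have q2 := hne m2
  have q3 := hne m3
  have q4 := hne m4
  have p1 := hp c
  have p2 := hp (d.next (mirror c))
  have p3 := hp x
  have p4 := hp (d.next (mirror x))
  rcases p1 with p1 | p1 <;> rcases p2 with p2 | p2 <;> rcases p3 with p3 | p3 <;>
    rcases p4 with p4 | p4 <;> omega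

end Diagram

/-! ### Removing blobs -/

namespace Diagram
variable {n : ℕ}

lemma vflip_e : (LRDiagram.e n).1.vflip = (LRDiagram.e n).1 := by
  apply ext'
  ext1
  · funext x; rcases x with x | x <;> rfl
  · funext x; rcases x with x | x <;> rfl
  · rfl

lemma vflip_f : (LRDiagram.f n).1.vflip = (LRDiagram.f n).1 := by
  apply ext'
  ext1
  · funext x; rcases x with x | x <;> rfl
  · funext x; rcases x with x | x <;> rfl
  · rfl

lemma hflip_e : (LRDiagram.e n).1.hflip = (LRDiagram.f n).1 := by
  apply ext'
  ext1
  · funext x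
    change mirror (Sum.swap (mirror x)) = Sum.swap x
    rcases x with x | x <;> simp [mirror]
  · funext x
    change (if (LRDiagram.column (mirror x) : ℕ) = 0 then [Blob.L] else []).map Blob.swap =
      if (LRDiagram.column x : ℕ) + 1 = n then [Blob.R] else []
    have h : (LRDiagram.column (mirror x) : ℕ) = 0 ↔ (LRDiagram.column x : ℕ) + 1 = n := by
      rcases x with x | x <;>
        simp only [mirror, LRDiagram.column, Sum.map_inl, Sum.map_inr, Sum.elim_inl,
          Sum.elim_inr, id, Fin.val_rev] <;> omega
    rw [apply_ite (List.map Blob.swap)]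
    simp only [h]
    rfl
  · rfl

lemma hflip_f : (LRDiagram.f n).1.hflip = (LRDiagram.e n).1 := by
  rw [← hflip_e, hflip_hflip]

/-- The total number of blobs on the strands (each strand counted twice). -/
def size (d : Diagram n) : ℕ := ∑ x, (d.word x).length

lemma size_vflip (d : Diagram n) : d.vflip.size = d.size :=
  Equiv.sum_comp (Equiv.sumComm (Fin n) (Fin n)) fun x => (d.word x).length

lemma size_hflip (d : Diagram n) : d.hflip.size = d.size := by
  refine Eq.trans (Finset.sum_congr rfl fun x _ => List.length_map _) ?_
  exact Equiv.sum_comp (Function.Involutive.toPerm mirror mirror_mirror)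
    fun x => (d.word x).length

/-- `d.Reduces d'`: the diagram `d'` has the strands and loops of `d` with fewer blobs, and arises
from `d` by omitting a factor `e` or `f`. -/
def Reduces (d d' : Diagram n) : Prop :=
  (∃ A B : LRDiagram n, (d = (A * LRDiagram.e n * B).1 ∨ d = (A * LRDiagram.f n * B).1) ∧
    d' = (A * B).1) ∧ d'.next = d.next ∧ d'.loops = d.loops ∧ d'.size < d.size

lemma Reduces.vflip {d d' : Diagram n} (h : d.Reduces d') : d.vflip.Reduces d'.vflip := by
  obtain ⟨⟨A, B, h1, h2⟩, h3, h4, h5⟩ := h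
  have hm : ∀ A B : LRDiagram n, (A * B).1 = A.1 * B.1 := fun _ _ => rfl
  refine ⟨⟨⟨_, B.2.vflip⟩, ⟨_, A.2.vflip⟩, h1.imp ?_ ?_, ?_⟩, ?_, h4, ?_⟩
  · rintro rfl
    simp only [hm, vflip_mul, vflip_e, mul_assoc]
  · rintro rfl
    simp only [hm, vflip_mul, vflip_f, mul_assoc]
  · rw [h2, hm, hm, vflip_mul]
  · funext x
    exact congrArg Sum.swap (congrFun h3 _)
  · rwa [size_vflip, size_vflip]

lemma Reduces.hflip {d d' : Diagram n} (h : d.Reduces d') : d.hflip.Reduces d'.hflip := by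
  obtain ⟨⟨A, B, h1, h2⟩, h3, h4, h5⟩ := h
  have hm : ∀ A B : LRDiagram n, (A * B).1 = A.1 * B.1 := fun _ _ => rfl
  refine ⟨⟨⟨_, A.2.hflip⟩, ⟨_, B.2.hflip⟩, h1.symm.imp ?_ ?_, ?_⟩, ?_,
    congrArg (Multiset.map Prod.swap) h4, ?_⟩
  · rintro rfl
    simp only [hm, hflip_mul, hflip_f]
  · rintro rfl
    simp only [hm, hflip_mul, hflip_e]
  · rw [h2, hm, hm, hflip_mul]
  · funext x
    exact congrArg mirror (congrFun h3 _)
  · rwa [size_hflip, size_hflip]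

/-- Remove the first blob on the strand at `x`. -/
def dropFirst (d : Diagram n) (x : Point n) : Diagram n where
  next := d.next
  word y := if y = x then (d.word x).tail else if y = d.next x then (d.word y).dropLast
    else d.word y
  loops := d.loops
  next_next := d.next_next
  next_ne := d.next_ne
  word_next y := by
    have h0 := d.next_ne x
    by_cases h1 : y = x
    · subst h1
      simp [h0, d.word_next]
    · by_cases h2 : y = d.next x
      · subst h2
        simp [h0, d.next_next, d.word_next]
      · have h3 : d.next y ≠ x := fun e => h2 (by rw [← e, d.next_next])
        have h4 : d.next y ≠ d.next x := fun e => h1 (d.proper.inj e)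
        simp [h1, h2, h3, h4, d.word_next]

lemma dropFirst_sublist (d : Diagram n) (x y : Point n) :
    ((d.dropFirst x).word y).Sublist (d.word y) := by
  change (if y = x then (d.word x).tail else if y = d.next x then (d.word y).dropLast
    else d.word y).Sublist _
  split_ifs with h1 h2
  · subst h1; exact List.tail_sublist _
  · exact List.dropLast_sublist _
  · exact List.Sublist.refl _

lemma IsLeftRight.dropFirst {d : Diagram n} (h : d.IsLeftRight) (x : Point n) :
    (d.dropFirst x).IsLeftRight :=
  ⟨h.planar, fun y hy => h.left y ((dropFirst_sublist d x y).subset hy),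
    fun y hy => h.right y ((dropFirst_sublist d x y).subset hy)⟩

lemma size_dropFirst {d : Diagram n} {x : Point n} (h : d.word x ≠ []) :
    (d.dropFirst x).size < d.size := by
  refine Finset.sum_lt_sum (fun y _ => (dropFirst_sublist d x y).length_le)
    ⟨x, Finset.mem_univ x, ?_⟩
  have : (d.dropFirst x).word x = (d.word x).tail := if_pos rfl
  rw [this, List.length_tail]
  have := List.length_pos_iff.mpr h
  omega

/-- A strand with both ends on the top edge does not carry both kinds of blobs, as it is separated
from the left or from the right edge by a strand from top to bottom. -/
lemma IsLeftRight.not_both {d : Diagram n} (h : d.IsLeftRight) (hn : Odd n) {x : Point n}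
    (h1 : pos x < n) (h2 : pos (d.next x) < n) (hL : Blob.L ∈ d.word x)
    (hR : Blob.R ∈ d.word x) : False := by
  obtain ⟨t, ht1, ht2⟩ := d.exists_through hn
  have t1 : t ≠ x := by rintro rfl; omega
  have t2 : t ≠ d.next x := by rintro rfl; rw [d.next_next] at ht2; omega
  have := h.left x hL t t1 t2 (by omega)
  have := h.right x hR t t1 t2 (by omega)
  omega

/-- Here `i` is the first end of an arc, or the top end of a strand from top to bottom. -/
lemma exists_reduces_of_left {d : Diagram n} (h : d.IsLeftRight) (hn : Odd n) {i : Fin n}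
    {w : List Blob} (hi : d.word (Sum.inl i) = Blob.L :: w)
    (hlt : (i : ℕ) < pos (d.next (Sum.inl i))) : ∃ d', d.Reduces d' := by
  have hw : (d.dropFirst (Sum.inl i)).word (Sum.inl i) = (d.word (Sum.inl i)).tail := if_pos rfl
  obtain ⟨A, B, hA, hB⟩ := exists_mul_e_mul hn h (h.dropFirst (Sum.inl i)) rfl rfl
    (by rw [hw, hi]; rfl) (fun x h1 h2 => by simp [dropFirst, h1, h2]) hlt
  exact ⟨_, ⟨A, B, Or.inl hA, hB⟩, rfl, rfl, size_dropFirst (by simp [hi])⟩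

lemma exists_reduces_of_hflip {d : Diagram n} (h : ∃ d', d.hflip.Reduces d') :
    ∃ d', d.Reduces d' := by
  obtain ⟨d', hd'⟩ := h
  exact ⟨_, by simpa only [hflip_hflip] using hd'.hflip⟩

lemma exists_reduces_of_right {d : Diagram n} (h : d.IsLeftRight) (hn : Odd n) {i : Fin n}
    {w : List Blob} (hi : d.word (Sum.inl i) = Blob.R :: w)
    (hlt : pos (d.next (Sum.inl i)) < i ∨ n ≤ pos (d.next (Sum.inl i))) :
    ∃ d', d.Reduces d' := by
  apply exists_reduces_of_hflip
  refine exists_reduces_of_left h.hflip hn (i := Fin.rev i) (w := w.map Blob.swap) ?_ ?_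
  · change (d.word (Sum.inl (Fin.rev (Fin.rev i)))).map Blob.swap = _
    rw [Fin.rev_rev, hi]
    rfl
  · change _ < pos (mirror (d.next (Sum.inl (Fin.rev (Fin.rev i)))))
    rw [Fin.rev_rev, Fin.val_rev]
    have := pos_mirror (d.next (Sum.inl i))
    omega

lemma exists_reduces_of_top {d : Diagram n} (h : d.IsLeftRight) (hn : Odd n) {i : Fin n}
    (hi : d.word (Sum.inl i) ≠ []) : ∃ d', d.Reduces d' := by
  -- for a strand from top to bottom, the blob closest to the top is removed; otherwise all blobs are
  -- of one kind, and the first one seen from the left or the right end is removed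
  have arc : ∀ i j : Fin n, i < j → d.next (Sum.inl i) = Sum.inl j → d.word (Sum.inl i) ≠ [] →
      ∃ d', d.Reduces d' := by
    intro i j hij hd hi
    rcases hw : d.word (Sum.inl i) with _ | ⟨_ | _, w⟩
    · exact absurd hw hi
    · exact exists_reduces_of_left h hn hw (by rw [hd]; exact hij)
    · have hd' : d.next (Sum.inl j) = Sum.inl i := by rw [← hd, d.next_next]
      have hj : d.word (Sum.inl j) = (d.word (Sum.inl i)).reverse := by rw [← hd, d.word_next]
      rcases hw' : d.word (Sum.inl j) with _ | ⟨_ | _, w'⟩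
      · rw [hw, hw'] at hj
        simp at hj
      · refine absurd (h.not_both hn (x := Sum.inl i) i.2 (by rw [hd]; exact j.2) ?_ ?_) id
        · rw [← List.mem_reverse, ← hj, hw']
          simp
        · simp [hw]
      · exact exists_reduces_of_right h hn hw' (Or.inl (by rw [hd']; exact hij))
  rcases hd : d.next (Sum.inl i) with j | j
  · rcases lt_trichotomy i j with hij | rfl | hij
    · exact arc i j hij hd hi
    · exact absurd hd (d.next_ne _)
    · refine arc j i hij (by rw [← hd, d.next_next]) ?_
      rw [← hd, d.word_next]
      simpa using hi
  · have hj : n ≤ pos (d.next (Sum.inl i)) := by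
      rw [hd]
      simp only [pos]
      omega
    rcases hw : d.word (Sum.inl i) with _ | ⟨_ | _, w⟩
    · exact absurd hw hi
    · exact exists_reduces_of_left h hn hw (by omega)
    · exact exists_reduces_of_right h hn hw (Or.inr hj)

/-- Unless a left-right diagram has no blobs on its strands, one blob can be removed by omitting a
factor `e` or `f`. -/
lemma exists_reduces {d : Diagram n} (h : d.IsLeftRight) (hn : Odd n) {x : Point n}
    (hx : d.word x ≠ []) : ∃ d', d.Reduces d' := by
  rcases x with i | i
  · exact exists_reduces_of_top h hn hx
  · obtain ⟨d', hd'⟩ := exists_reduces_of_top h.vflip hn (i := i) hx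
    exact ⟨_, by simpa only [vflip_vflip] using hd'.vflip⟩

end Diagram

/-! ### The quotient -/

section
variable {k : Type*} [CommRing k] {n : ℕ}

namespace SymplecticBlob

/-- The class of a diagram in the quotient by the ideal generated by `e - 1` and `f - 1`. -/
noncomputable def mkDiagram (n : ℕ) (δ : k) :
    LRDiagram n →* (ideal n δ 1 1 δ δ 1).ringCon.Quotient :=
  (((RingCon.mkₐ k (ideal n δ 1 1 δ δ 1).ringCon).comp
    (RingQuot.mkAlgHom k (Straighten (n := n) δ 1 1 δ δ 1))).toRingHom.toMonoidHom).comp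
      (MonoidAlgebra.of k (LRDiagram n))

lemma mkDiagram_apply (δ : k) (d : LRDiagram n) : mkDiagram n δ d =
    RingCon.mk' _ (diagram δ 1 1 δ δ 1 d) := rfl

lemma mkDiagram_eq_one (δ : k) {g : LRDiagram n} (hg : g = LRDiagram.e n ∨ g = LRDiagram.f n) :
    mkDiagram n δ g = 1 := by
  have h : diagram δ 1 1 δ δ 1 g - 1 ∈ ideal n δ 1 1 δ δ 1 :=
    TwoSidedIdeal.subset_span (by rcases hg with rfl | rfl <;> simp)
  rw [mkDiagram_apply, ← map_one (RingCon.mk' (ideal n δ 1 1 δ δ 1).ringCon)]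
  exact (RingCon.eq _).mpr ((TwoSidedIdeal.rel_iff _ _ _).mpr h)

lemma mkDiagram_reduces (δ : k) {d d' : LRDiagram n} (h : d.1.Reduces d'.1) :
    mkDiagram n δ d = mkDiagram n δ d' := by
  obtain ⟨⟨A, B, h1, h2⟩, -⟩ := h
  rw [Subtype.ext h2]
  have h3 : ∃ g, (g = LRDiagram.e n ∨ g = LRDiagram.f n) ∧ d = A * g * B :=
    h1.elim (fun h => ⟨_, Or.inl rfl, Subtype.ext h⟩) (fun h => ⟨_, Or.inr rfl, Subtype.ext h⟩)
  obtain ⟨g, hg, rfl⟩ := h3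
  rw [map_mul, map_mul, map_mul, mkDiagram_eq_one δ hg, mul_one]

lemma mkDiagram_straighten (δ : k) {d d' : LRDiagram n} {c : k}
    (h : Straighten δ 1 1 δ δ 1 (MonoidAlgebra.of k _ d) (c • MonoidAlgebra.of k _ d')) :
    mkDiagram n δ d = c • mkDiagram n δ d' := by
  have h1 := RingQuot.mkAlgHom_rel k h
  rw [map_smul] at h1
  refine (congrArg (RingCon.mkₐ k (ideal n δ 1 1 δ δ 1).ringCon) h1).trans ?_
  exact map_smul _ _ _

/-- The straightening relations evaluate each closed loop. -/
lemma mkDiagram_addLoops_singleton (δ : k) (t : ℕ × ℕ) (d : LRDiagram n) :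
    mkDiagram n δ (LRDiagram.addLoops {t} d) = loopValue δ t • mkDiagram n δ d := by
  obtain ⟨i, j⟩ := t
  induction i using Nat.twoStepInduction generalizing j with
  | zero =>
    induction j using Nat.twoStepInduction with
    | zero => simpa [loopValue] using mkDiagram_straighten δ (.loop d _ _ .plain)
    | one => simpa [loopValue] using mkDiagram_straighten δ (.loop d _ _ .R)
    | more j _ ih =>
      rw [mkDiagram_straighten δ (.loopRR d 0 j), ih]
      simp [loopValue]
  | one =>
    induction j using Nat.twoStepInduction with
    | zero => simpa [loopValue] using mkDiagram_straighten δ (.loop d _ _ .L)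
    | one => simpa [loopValue] using mkDiagram_straighten δ (.loop d _ _ .LR)
    | more j _ ih =>
      rw [mkDiagram_straighten δ (.loopRR d 1 j), ih]
      simp [loopValue]
  | more i _ ih =>
    rw [mkDiagram_straighten δ (.loopLL d i j), ih]
    simp [loopValue]

lemma mkDiagram_addLoops (δ : k) (m : Multiset (ℕ × ℕ)) (d : LRDiagram n) :
    mkDiagram n δ (LRDiagram.addLoops m d) = (m.map (loopValue δ)).prod • mkDiagram n δ d := by
  induction m using Multiset.induction with
  | empty =>
    have : LRDiagram.addLoops 0 d = d :=
      Subtype.ext (Diagram.ext' (Strands.ext rfl rfl (add_zero _)))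
    simp [this]
  | cons t m ih =>
    have : LRDiagram.addLoops (t ::ₘ m) d = LRDiagram.addLoops {t} (LRDiagram.addLoops m d) := by
      refine Subtype.ext (Diagram.ext' (Strands.ext rfl rfl ?_))
      change d.1.loops + t ::ₘ m = d.1.loops + m + {t}
      rw [add_assoc, add_comm m, Multiset.singleton_add]
    rw [this, mkDiagram_addLoops_singleton, ih, smul_smul]
    simp

/-- A Temperley-Lieb diagram, as a left-right blob diagram. -/
def ofTL (d : TLDiagram n) : LRDiagram n := ⟨d.1, d.2.isLeftRight⟩

/-- In the quotient, all blobs can be removed. -/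
lemma mkDiagram_eq (hn : Odd n) (δ : k) (d : LRDiagram n) : mkDiagram n δ d =
    (d.1.loops.map (loopValue δ)).prod • mkDiagram n δ (ofTL (LRDiagram.removeBlobs d)) := by
  induction hs : d.1.size using Nat.strong_induction_on generalizing d with
  | _ s ih =>
    subst hs
    by_cases hx : ∃ x, d.1.word x ≠ []
    · obtain ⟨x, hx⟩ := hx
      obtain ⟨d', hd'⟩ := Diagram.exists_reduces d.2 hn hx
      have hLR : d'.IsLeftRight := by
        obtain ⟨⟨A, B, -, h⟩, -⟩ := hd'
        rw [h]
        exact (A * B).2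
      have h1 := ih _ hd'.2.2.2 ⟨d', hLR⟩ rfl
      have h2 : LRDiagram.removeBlobs ⟨d', hLR⟩ = LRDiagram.removeBlobs d :=
        Subtype.ext (Diagram.ext' (Strands.ext hd'.2.1 rfl rfl))
      rw [mkDiagram_reduces δ (d' := ⟨d', hLR⟩) hd', h1, h2]
      simp only [hd'.2.2.1]
    · push Not at hx
      rw [← mkDiagram_addLoops]
      congr 1
      exact Subtype.ext (Diagram.ext' (Strands.ext rfl (funext hx) (zero_add _).symm))

/-- Removing blobs turns `e` and `f` into the identity diagram. -/
lemma ideal_le_ker (hn : Odd n) (δ : k) :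
    (ideal n δ 1 1 δ δ 1).ringCon ≤ RingCon.ker (toTL hn δ).toRingHom := by
  have h1 : LRDiagram.toTL hn δ (LRDiagram.e n) = 1 :=
    (LRDiagram.toTL_congr hn δ (d' := 1) rfl rfl).trans (map_one _)
  have h2 : LRDiagram.toTL hn δ (LRDiagram.f n) = 1 :=
    (LRDiagram.toTL_congr hn δ (d' := 1) rfl rfl).trans (map_one _)
  have h3 : ideal n δ 1 1 δ δ 1 ≤ TwoSidedIdeal.ker (toTL hn δ).toRingHom := by
    refine TwoSidedIdeal.span_le.mpr ?_
    rintro _ (rfl | rfl)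
    · change diagram δ 1 1 δ δ 1 (LRDiagram.e n) - 1 ∈ TwoSidedIdeal.ker (toTL hn δ)
      rw [TwoSidedIdeal.mem_ker, map_sub, toTL_diagram, h1, map_one, sub_self]
    · change diagram δ 1 1 δ δ 1 (LRDiagram.f n) - 1 ∈ TwoSidedIdeal.ker (toTL hn δ)
      rw [TwoSidedIdeal.mem_ker, map_sub, toTL_diagram, h2, map_one, sub_self]
  intro x y hxy
  exact (TwoSidedIdeal.ker_ringCon (f := toTL hn δ)).mp ((TwoSidedIdeal.rel_iff _ x y).mpr
    (h3 ((TwoSidedIdeal.rel_iff _ x y).mp hxy)))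

/-- The algebra map from the quotient to the Temperley-Lieb algebra. -/
noncomputable def quotientToTL (hn : Odd n) (δ : k) :
    (ideal n δ 1 1 δ δ 1).ringCon.Quotient →ₐ[k] TemperleyLieb k n δ :=
  RingCon.liftₐ _ (toTL hn δ) (ideal_le_ker hn δ)

lemma quotientToTL_mkDiagram (hn : Odd n) (δ : k) (d : LRDiagram n) :
    quotientToTL hn δ (mkDiagram n δ d) = LRDiagram.toTL hn δ d :=
  toTL_diagram hn δ d

lemma quotientToTL_ofTL (hn : Odd n) (δ : k) (d : TLDiagram n) :
    quotientToTL hn δ (mkDiagram n δ (ofTL d)) = TemperleyLieb.diagram d := by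
  have h1 : (ofTL d).1.loops = 0 := d.2.loops
  have h2 : LRDiagram.removeBlobs (ofTL d) = d := Subtype.ext d.2.bare_eq
  rw [quotientToTL_mkDiagram, LRDiagram.toTL_apply, h1, h2, Multiset.map_zero,
    Multiset.prod_zero, one_smul]

/-- The linear map that sends a Temperley-Lieb diagram to its class is inverse to the removal of
blobs. -/
lemma quotientToTL_bijective (hn : Odd n) (δ : k) :
    Function.Bijective (quotientToTL (k := k) hn δ) := by
  set G : TemperleyLieb k n δ →ₗ[k] (ideal n δ 1 1 δ δ 1).ringCon.Quotient :=
    TemperleyLieb.lift fun d => mkDiagram n δ (ofTL d) with hG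
  have h1 : Function.RightInverse G (quotientToTL hn δ) := by
    have : (quotientToTL hn δ).toLinearMap ∘ₗ G = LinearMap.id := by
      apply TemperleyLieb.hom_ext
      intro d
      rw [LinearMap.comp_apply, hG, TemperleyLieb.lift_diagram]
      exact quotientToTL_ofTL hn δ d
    exact LinearMap.congr_fun this
  have h2 : Function.LeftInverse G (quotientToTL hn δ) := by
    set π := (RingCon.mkₐ k (ideal n δ 1 1 δ δ 1).ringCon).comp
      (RingQuot.mkAlgHom k (Straighten (n := n) δ 1 1 δ δ 1)) with hπ
    have hsurj : Function.Surjective π :=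
      (RingCon.mkₐ_surjective (α := k) _).comp (RingQuot.mkAlgHom_surjective k _)
    have key : ∀ d, G (quotientToTL hn δ (mkDiagram n δ d)) = mkDiagram n δ d := by
      intro d
      rw [quotientToTL_mkDiagram, LRDiagram.toTL_apply, map_smul, hG,
        TemperleyLieb.lift_diagram, ← mkDiagram_eq hn]
    intro q
    obtain ⟨a, rfl⟩ := hsurj q
    induction a using MonoidAlgebra.induction_on with
    | of d => exact key d
    | add a b ha hb => rw [map_add, map_add, map_add, ha, hb]
    | smul r a ha => rw [map_smul, map_smul, map_smul, ha]
  exact ⟨h2.injective, h1.surjective⟩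

end SymplecticBlob
end
end SympBlob

/-- For `n ≥ 3` odd and `δ = κL = κR`, `δL = δR = κLR = 1`, the quotient of the symplectic blob algebra
by the ideal generated by `e - 1` and `f - 1` is isomorphic to the Temperley-Lieb algebra, by the map
that removes all blobs from the diagrams. -/
theorem proposition7p1p1 {k : Type*} [Field k] (n : ℕ) (hn : 3 ≤ n) (hodd : Odd n)
    (δ δL δR κL κR κLR : k) (hκL : δ = κL) (hκR : δ = κR)
    (hδL : δL = 1) (hδR : δR = 1) (hκLR : κLR = 1) :
    ∃ Φ : (SympBlob.SymplecticBlob.ideal n δ δL δR κL κR κLR).ringCon.Quotient ≃ₐ[k]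
        SympBlob.TemperleyLieb k n δ,
      ∀ d : SympBlob.LRDiagram n, d.1.loops = 0 →
        Φ (RingCon.mk' _ (SympBlob.SymplecticBlob.diagram δ δL δR κL κR κLR d)) =
          SympBlob.TemperleyLieb.diagram (SympBlob.LRDiagram.removeBlobs d) := by
  subst hκL hκR hδL hδR hκLR
  refine ⟨AlgEquiv.ofBijective (SympBlob.SymplecticBlob.quotientToTL hodd δ)
    (SympBlob.SymplecticBlob.quotientToTL_bijective hodd δ), fun d hd => ?_⟩
  refine (SympBlob.SymplecticBlob.quotientToTL_mkDiagram hodd δ d).trans ?_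
  rw [SympBlob.LRDiagram.toTL_apply, hd, Multiset.map_zero, Multiset.prod_zero, one_smul]
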